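/- An instance $I$ of the \emph{two-sided model with one-sided ties} consists of a finite bipartite graph $G=(A\cup B,E)$ (agents $A$, jobs $B$) in which every agent $a\in A$ ranks her neighbours strictly, while every job $b\in B$ is indifferent between all its neighbours; being unmatched is the worst outcome for every vertex. For matchings $M,N$ of $G$, an agent prefers $M$ to $N$ if she is matched in $M$ and is in $N$ either unmatched or matched to a job that she ranks strictly lower; a job prefers $M$ to $N$ if it is matched in $M$ and unmatched in $N$. Let $\phi_I(M,N)$ be the number of vertices of $A\cup B$ that prefer $M$ to $N$. A matching $M$ is \emph{popular} in $I$ if $\phi_I(M,N)\ge\phi_I(N,M)$ for every matching $N$ of $G$. A matching is \emph{robust popular} with respect to two instances $(I,I')$ if it is popular in both. \textbf{Theorem.} There is a polynomial-time algorithm (a single random access machine program, operating on natural numbers with unit-cost addition and subtraction but no multiplication, whose running time is at most $p(|A|+|B|+|E|)$ for a fixed polynomial $p$) which, given a pair $(I,I')$ of instances of the two-sided model with one-sided ties that have the same underlying graph $G=(A\cup B,E)$ and differ only in the preference order of a single agent $a\in A$, decides whether a robust popular matching with respect to $I$ and $I'$ exists, and outputs one if it does. -/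

import Mathlib

/-!
## The two-sided model with one-sided ties
-/

namespace PopularMatching

/-- An instance of the two-sided model with one-sided ties, with agents `A = Fin m` and jobs
`B = Fin n`. Every agent has a preference list, which enumerates her neighbours without repetition
in strictly decreasing order of preference; the edges of the bipartite graph are the pairs `(a, b)`
with `b` on the list of `a`. A job puts all its neighbours into one tie, so it carries no data. -/
structure Market (m n : ℕ) where
  list : Fin m → List (Fin n)
  nodup : ∀ a, (list a).Nodup

variable {m n : ℕ}

namespace Market

/-- The edge relation of the underlying bipartite graph. -/
def Edge (I : Market m n) (a : Fin m) (b : Fin n) : Prop := b ∈ I.list a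

/-- Agent `a` strictly prefers her neighbour `b` to her neighbour `c`. -/
def Above (I : Market m n) (a : Fin m) (b c : Fin n) : Prop :=
  I.Edge a b ∧ I.Edge a c ∧ (I.list a).idxOf b < (I.list a).idxOf c

/-- The number of vertices plus the number of edges. -/
def size (I : Market m n) : ℕ := m + n + ∑ a, (I.list a).length

/-- `M` is a matching: a set of pairwise disjoint edges. -/
def IsMatching (I : Market m n) (M : Finset (Fin m × Fin n)) : Prop :=
  (∀ e ∈ M, I.Edge e.1 e.2) ∧ ∀ e ∈ M, ∀ f ∈ M, e ≠ f → e.1 ≠ f.1 ∧ e.2 ≠ f.2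

/-- Agent `a` prefers the matching `M` to the matching `N`: she is matched in `M`, and in `N` she is
either unmatched or matched to a less preferred job. -/
def AgentPrefers (I : Market m n) (M N : Finset (Fin m × Fin n)) (a : Fin m) : Prop :=
  ∃ b, (a, b) ∈ M ∧ ∀ c, (a, c) ∈ N → I.Above a b c

/-- Job `b` prefers the matching `M` to the matching `N`: it is matched in `M` and not in `N`. -/
def JobPrefers (M N : Finset (Fin m × Fin n)) (b : Fin n) : Prop :=
  (∃ a, (a, b) ∈ M) ∧ ¬ ∃ a, (a, b) ∈ N

instance (I : Market m n) (a : Fin m) (b : Fin n) : Decidable (I.Edge a b) := by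
  unfold Edge; infer_instance

instance (I : Market m n) (a : Fin m) (b c : Fin n) : Decidable (I.Above a b c) := by
  unfold Above; infer_instance

instance (I : Market m n) (M N : Finset (Fin m × Fin n)) : DecidablePred (I.AgentPrefers M N) :=
  fun a => by unfold AgentPrefers; infer_instance

instance (M N : Finset (Fin m × Fin n)) : DecidablePred (JobPrefers M N) :=
  fun b => by unfold JobPrefers; infer_instance

/-- `φ(M, N)`, the number of vertices (agents and jobs) that prefer `M` to `N`. -/
def votes (I : Market m n) (M N : Finset (Fin m × Fin n)) : ℕ :=
  (Finset.univ.filter (I.AgentPrefers M N)).card + (Finset.univ.filter (JobPrefers M N)).card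

/-- `M` is a popular matching: no matching beats it in a majority vote. -/
def IsPopular (I : Market m n) (M : Finset (Fin m × Fin n)) : Prop :=
  I.IsMatching M ∧ ∀ N, I.IsMatching N → I.votes N M ≤ I.votes M N

/-- `M` is a robust popular matching for the pair `(I, J)`: it is popular in both instances. -/
def IsRobustPopular (I J : Market m n) (M : Finset (Fin m × Fin n)) : Prop :=
  I.IsPopular M ∧ J.IsPopular M

/-- `I` and `J` have the same underlying graph and differ only in the preference order of a single
agent. -/
def DifferInOneAgent (I J : Market m n) : Prop :=
  (∀ a b, I.Edge a b ↔ J.Edge a b) ∧ ∃ a, ∀ x, x ≠ a → I.list x = J.list x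

/-- The preference lists of all agents, each preceded by its length, as one word. -/
def code (I : Market m n) : List ℕ :=
  (List.finRange m).flatMap fun a => (I.list a).length :: (I.list a).map Fin.val

end Market

/-- The input word of the algorithm: the number of agents, the number of jobs, the preference lists
of the first instance and those of the second. -/
def inputWord (I J : Market m n) : List ℕ := m :: n :: (I.code ++ J.code)

/-!
## Random access machines

Programs over finitely many arrays of natural numbers with indirect addressing, addition and
truncated subtraction (no multiplication), at unit cost for each operation.
-/

/-- The memory: `s r i` is the content of cell `i` of array `r`. -/
abbrev Store := ℕ → ℕ → ℕ

/-- Arithmetic expressions. -/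
inductive Expr where
  | const (k : ℕ)
  | read (r : ℕ) (i : Expr)
  | plus (e f : Expr)
  | minus (e f : Expr)

namespace Expr

/-- The value of an expression. -/
def eval (s : Store) : Expr → ℕ
  | const k => k
  | read r i => s r (i.eval s)
  | plus e f => e.eval s + f.eval s
  | minus e f => e.eval s - f.eval s

/-- The number of elementary operations needed to evaluate an expression. -/
def cost : Expr → ℕ
  | const _ => 1
  | read _ i => i.cost + 1
  | plus e f => e.cost + f.cost + 1
  | minus e f => e.cost + f.cost + 1

end Expr

/-- Programs. A condition `e` counts as true when its value is not zero. -/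
inductive Prog where
  | skip
  | write (r : ℕ) (i e : Expr)
  | seq (c d : Prog)
  | cond (e : Expr) (c d : Prog)
  | loop (e : Expr) (c : Prog)

/-- The memory after writing `v` into cell `i` of array `r`. -/
def Store.set (s : Store) (r i v : ℕ) : Store :=
  Function.update s r (Function.update (s r) i v)

/-- `Exec c s s' t`: the program `c`, started with memory `s`, halts after exactly `t` steps with
memory `s'`. -/
inductive Exec : Prog → Store → Store → ℕ → Prop where
  | skip (s : Store) : Exec .skip s s 1
  | write (r : ℕ) (i e : Expr) (s : Store) :
      Exec (.write r i e) s (s.set r (i.eval s) (e.eval s)) (i.cost + e.cost + 1)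
  | seq {c d : Prog} {s₁ s₂ s₃ : Store} {t₁ t₂ : ℕ} :
      Exec c s₁ s₂ t₁ → Exec d s₂ s₃ t₂ → Exec (.seq c d) s₁ s₃ (t₁ + t₂)
  | cond_true {e : Expr} {c d : Prog} {s s₁ : Store} {t : ℕ} :
      e.eval s ≠ 0 → Exec c s s₁ t → Exec (.cond e c d) s s₁ (e.cost + 1 + t)
  | cond_false {e : Expr} {c d : Prog} {s s₁ : Store} {t : ℕ} :
      e.eval s = 0 → Exec d s s₁ t → Exec (.cond e c d) s s₁ (e.cost + 1 + t)
  | loop_true {e : Expr} {c : Prog} {s s₁ s₂ : Store} {t₁ t₂ : ℕ} :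
      e.eval s ≠ 0 → Exec c s s₁ t₁ → Exec (.loop e c) s₁ s₂ t₂ →
      Exec (.loop e c) s s₂ (e.cost + 1 + t₁ + t₂)
  | loop_false {e : Expr} {c : Prog} {s : Store} :
      e.eval s = 0 → Exec (.loop e c) s s (e.cost + 1)

/-- The initial memory on input `w`: the word `w` stands in array `0`, all other cells are zero. -/
def inputStore (w : List ℕ) : Store := fun r i => if r = 0 then w.getD i 0 else 0

/-- The verdict, in cell `0` of array `1` of the final memory. -/
def verdict (s : Store) : ℕ := s 1 0

/-- The set of edges `(a, b)` written in array `1` of the final memory: cell `a + 1` holds `b + 1`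
if `a` is matched to `b`, and holds `0` (or any other number) if `a` is unmatched. -/
def outputEdges (m n : ℕ) (s : Store) : Finset (Fin m × Fin n) :=
  Finset.univ.filter fun e => s 1 (e.1.val + 1) = e.2.val + 1

end PopularMatching

/-! Relative to a fixed matching M, the margin φ(N, M) − φ(M, N) of a rival N is a sum over agents:
each contributes her own vote, plus one if N matches her, minus one if M matches her. The last two
terms add up to the votes of the jobs, since a job only cares about being matched. So popularity
says that M is optimal for an assignment problem.

Call c better than b for an agent if it is better in at least one instance. The instances differ at
one agent, so the margin of N under these merged votes equals its margin in I or in J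
(`sum_vote_either`). Hence robust popularity means that no rival has positive merged margin, and
duality turns this into job levels 0, 1, 2 (`Certifies`). Weak duality is `Certifies.isPopular`; the
converse, `exists_certifies`, takes the levels from a potential (`exists_potential`).

Assignment and levels must be found together. The algorithm keeps upper bounds U for the levels of
all solutions, initially 2. A slot (a job or an outside option) is usable at U if its inequalities
hold there (`Good`). If a solution meets the bound U at the slot of an agent, it meets U at every
slot usable for her at U (`level_eq_of_good`). A first auction tries to cover the jobs of positive
level. When it gets stuck, every solution lies strictly below U at each such job left uncovered
(`lt_level_of_uncovered`), so U can be lowered there. Once all of them are covered, a second auction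
offers all slots without uncovering a held one. Either every agent gets a slot, and U is itself
certified, or a free agent refutes every solution (`not_solution_of_free`).

The auction plays the role of alternating paths: each bid raises one price by one, no price exceeds
m + 2, and as at most m slots are held, some value in 1, ..., m + 1 is not a price. That gap
separates the slots out of reach. Levels and prices are bounded, so the number of rounds is
polynomial. Correctness and running time of the machine program are proved by a timed Hoare logic
(`Runs`). -/

namespace PopularMatching

/-! ### Potentials for arc weights without positive cycles -/

section Potential

variable {V : Type*}

/-- The total weight of the steps of a walk, given as the list of its vertices. -/
def walkWeight (w : V → V → ℤ) : List V → ℤ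
  | u :: v :: l => w u v + walkWeight w (v :: l)
  | _ => 0

theorem walkWeight_append (w : V → V → ℤ) (l₁ l₂ : List V) (u : V) :
    walkWeight w (l₁ ++ u :: l₂) = walkWeight w (l₁ ++ [u]) + walkWeight w (u :: l₂) := by
  induction l₁ with
  | nil => simp [walkWeight]
  | cons x l ih =>
    cases l with
    | nil => simp [walkWeight]
    | cons y l =>
      simp only [List.cons_append, walkWeight] at ih ⊢
      rw [ih]; ring

theorem sum_map_eq_walkWeight (w : V → V → ℤ) (σ : V → V) (l : List V) (u : V)
    (h : ∀ i (hi : i + 1 < (l ++ [u]).length), σ ((l ++ [u])[i]) = (l ++ [u])[i + 1]) :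
    (l.map fun x => w x (σ x)).sum = walkWeight w (l ++ [u]) := by
  induction l with
  | nil => simp [walkWeight]
  | cons x l ih =>
    have ih' := ih fun i hi => by
      have := h (i + 1) (by simpa using hi)
      simpa using this
    have h0 := h 0 (by simp)
    cases l with
    | nil => simp at h0; simp [walkWeight, h0]
    | cons y l =>
      simp at h0
      simp only [List.map_cons, List.sum_cons, List.cons_append, walkWeight] at ih' ⊢
      rw [ih', h0]

/-- If no permutation along arcs has positive weight, then the arcs admit a potential. -/
theorem exists_potential [Fintype V] [DecidableEq V] (r : V → V → Prop) (w : V → V → ℤ)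
    (h : ∀ σ : Equiv.Perm V, (∀ v, σ v = v ∨ r v (σ v)) →
      ∑ v, (if σ v = v then 0 else w v (σ v)) ≤ 0) :
    ∃ p : V → ℤ, ∀ u v, r u v → u ≠ v → p u + w u v ≤ p v := by
  classical
  -- Simple walks starting at v. There are finitely many, so a heaviest one exists.
  let P : V → Set (List V) := fun v => {l | l.head? = some v ∧ l.Nodup ∧ l.IsChain r}
  have hfin : ∀ v, (P v).Finite := fun v =>
    (@Set.toFinite _ {l : List V | l.Nodup}
      (inferInstanceAs (Finite {l : List V // l.Nodup}))).subset fun l hl => hl.2.1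
  have hmax : ∀ v, ∃ l ∈ P v, ∀ l' ∈ P v, walkWeight w l' ≤ walkWeight w l := fun v =>
    Set.exists_max_image (P v) (walkWeight w) (hfin v) ⟨[v], by simp [P]⟩
  choose best hbest hle using hmax
  refine ⟨fun v => - walkWeight w (best v), fun u v huv hne => ?_⟩
  suffices w u v + walkWeight w (best v) ≤ walkWeight w (best u) by simp only; linarith
  obtain ⟨hhead, hnd, hch⟩ := hbest v
  obtain ⟨l, hl⟩ : ∃ l, best v = v :: l := by
    cases hb : best v with
    | nil => simp [hb] at hhead
    | cons x l => simp [hb] at hhead; exact ⟨l, by rw [hhead]⟩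
  rw [hl] at hnd hch ⊢
  by_cases hu : u ∈ v :: l
  -- Prepending u would repeat a vertex, so the walk is cut at u. Its part from v to u closes up
  -- with the arc from u to v to a cycle, of weight at most zero by hypothesis; the rest is a simple
  -- walk from u.
  · obtain ⟨l₁, l₂, hs⟩ := List.append_of_mem hu
    rw [hs] at hnd hch ⊢
    have h2 : u :: l₂ ∈ P u :=
      ⟨by simp, (List.nodup_append.1 hnd).2.1, (List.isChain_append.1 hch).2.1⟩
    have h3 := hle u _ h2
    rw [walkWeight_append]
    have hnd' : (l₁ ++ [u]).Nodup := by
      have : List.Sublist (l₁ ++ [u]) (l₁ ++ u :: l₂) := by simp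
      exact hnd.sublist this
    have hch' : (l₁ ++ [u]).IsChain r := by
      have : l₁ ++ u :: l₂ = (l₁ ++ [u]) ++ l₂ := by simp
      rw [this] at hch
      exact (List.isChain_append.1 hch).1
    obtain ⟨l₃, rfl⟩ : ∃ l₃, l₁ = v :: l₃ := by
      cases l₁ with
      | nil => simp at hs; exact absurd hs.1.symm hne
      | cons x l => simp at hs; exact ⟨l, by rw [hs.1]⟩
    set cy := v :: l₃ ++ [u] with hc
    have hlast : cy.formPerm u = v := by
      exact List.formPerm_cons_concat_apply_last v u l₃
    have hstep : ∀ i (hi : i + 1 < cy.length), cy.formPerm (cy[i]) = cy[i + 1] := fun i hi =>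
      List.formPerm_apply_lt_getElem cy hnd' i hi
    have hσ : ∀ x, cy.formPerm x = x ∨ r x (cy.formPerm x) := by
      intro x
      by_cases hx : x ∈ cy
      · right
        obtain ⟨i, hi, rfl⟩ := List.getElem_of_mem hx
        by_cases hi' : i + 1 < cy.length
        · rw [hstep i hi']
          exact List.isChain_iff_getElem.1 hch' i hi'
        · have : cy[i] = u := by
            have hi2 : i = (v :: l₃).length := by simp [hc] at hi hi' ⊢; omega
            subst hi2
            simp [hc]
          rw [this, hlast]; exact huv
      · exact Or.inl (List.formPerm_apply_of_notMem hx)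
    have hsum := h cy.formPerm hσ
    have hsum2 : ∑ x, (if cy.formPerm x = x then 0 else w x (cy.formPerm x))
        = ∑ x ∈ cy.toFinset, w x (cy.formPerm x) := by
      rw [← Finset.sum_subset (Finset.subset_univ cy.toFinset)]
      · refine Finset.sum_congr rfl fun x hx => if_neg ?_
        rw [List.mem_toFinset] at hx
        exact (List.formPerm_apply_mem_ne_self_iff cy hnd' x hx).2 (by simp [hc])
      · intro x _ hx
        rw [List.mem_toFinset] at hx
        simp [List.formPerm_apply_of_notMem hx]
    rw [hsum2, List.sum_toFinset _ hnd'] at hsum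
    have h4 := sum_map_eq_walkWeight w cy.formPerm (v :: l₃) u hstep
    rw [hc, List.map_append, List.sum_append, ← hc, h4] at hsum
    simp only [List.map_cons, List.map_nil, List.sum_cons, List.sum_nil, hlast] at hsum
    linarith
  · have : u :: v :: l ∈ P u := by
      refine ⟨by simp, List.nodup_cons.2 ⟨hu, hnd⟩, ?_⟩
      exact List.isChain_cons_cons.2 ⟨huv, hch⟩
    simpa [walkWeight] using hle u _ this

end Potential

/-! ### Robust popularity and its dual certificate -/

section Popularity

variable {m n : ℕ}

/-- The edge set of a partial assignment of jobs to agents. -/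
def edgesOf (f : Fin m → Option (Fin n)) : Finset (Fin m × Fin n) :=
  Finset.univ.filter fun e => f e.1 = some e.2

@[simp] theorem mem_edgesOf (f : Fin m → Option (Fin n)) (a : Fin m) (b : Fin n) :
    (a, b) ∈ edgesOf f ↔ f a = some b := by simp [edgesOf]

/-- No job is assigned twice. -/
def InjAssign (f : Fin m → Option (Fin n)) : Prop :=
  ∀ a a' b, f a = some b → f a' = some b → a = a'

theorem isMatching_edgesOf {I : Market m n} {f : Fin m → Option (Fin n)} :
    I.IsMatching (edgesOf f) ↔ (∀ a b, f a = some b → I.Edge a b) ∧ InjAssign f := by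
  constructor
  · rintro ⟨h1, h2⟩
    refine ⟨fun a b h => h1 (a, b) (by simpa using h), fun a a' b h h' => ?_⟩
    by_contra hne
    exact (h2 (a, b) (by simpa using h) (a', b) (by simpa using h')
      (by simpa using hne)).2 rfl
  · rintro ⟨h1, h2⟩
    refine ⟨fun e he => h1 e.1 e.2 (by simpa [edgesOf] using he), ?_⟩
    rintro ⟨a, b⟩ he ⟨a', b'⟩ he' hne
    simp only [mem_edgesOf] at he he'
    constructor
    · rintro rfl
      rw [he] at he'
      exact hne (by simpa using he')
    · rintro rfl
      exact hne (by simpa using h2 a a' b he he')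

theorem exists_eq_edgesOf {I : Market m n} {M : Finset (Fin m × Fin n)} (hM : I.IsMatching M) :
    ∃ f, M = edgesOf f := by
  classical
  refine ⟨fun a => if h : ∃ b, (a, b) ∈ M then some h.choose else none, ?_⟩
  ext ⟨a, b⟩
  rw [mem_edgesOf]
  constructor
  · intro h
    have hex : ∃ b, (a, b) ∈ M := ⟨b, h⟩
    rw [dif_pos hex]
    by_contra hne
    have := hM.2 _ hex.choose_spec _ h fun he => hne (by simpa using (Prod.mk.inj he).2)
    exact this.1 rfl
  · intro h
    split_ifs at h with hex
    have := hex.choose_spec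
    rwa [Option.some.inj h] at this

open Classical in
/-- The vote of an agent with preference relation `R` between the partners `x` and `y`. -/
noncomputable def vote (R : Fin n → Fin n → Prop) : Option (Fin n) → Option (Fin n) → ℤ
  | none, none => 0
  | some _, none => 1
  | none, some _ => -1
  | some b, some c => if b = c then 0 else if R b c then 1 else -1

/-- `1` for a job and `0` for none. -/
def weightOf : Option (Fin n) → ℤ
  | none => 0
  | some _ => 1

/-- Injectivity makes each covered job count once. This passes between agent sums and job sums, both
for the job votes and for the levels. -/
theorem sum_covered (g : Fin m → Option (Fin n)) (hg : InjAssign g) (q : Fin n → ℤ) :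
    ∑ a, (g a).elim 0 q = ∑ b, (open Classical in if ∃ a, g a = some b then q b else 0) := by
  classical
  have h1 : ∀ a, (g a).elim 0 q = ∑ b, if g a = some b then q b else 0 := by
    intro a
    cases h : g a <;> simp
  simp_rw [h1]
  rw [Finset.sum_comm]
  refine Finset.sum_congr rfl fun b _ => ?_
  split_ifs with h
  · obtain ⟨a, ha⟩ := h
    rw [Finset.sum_eq_single a]
    · simp [ha]
    · intro a' _ hne
      exact if_neg fun h' => hne (hg _ _ _ h' ha)
    · simp
  · push Not at h
    exact Finset.sum_eq_zero fun a _ => if_neg (h a)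

theorem Market.not_above_symm {I : Market m n} {a : Fin m} {b c : Fin n} (h : I.Above a b c) :
    ¬ I.Above a c b := fun h' => by
  have := h.2.2; have := h'.2.2; omega

theorem Market.above_total {I : Market m n} {a : Fin m} {b c : Fin n} (hb : I.Edge a b)
    (hc : I.Edge a c) (hne : b ≠ c) : I.Above a b c ∨ I.Above a c b := by
  rcases lt_trichotomy ((I.list a).idxOf b) ((I.list a).idxOf c) with h | h | h
  · exact Or.inl ⟨hb, hc, h⟩
  · exact absurd ((List.idxOf_inj (x := b) (y := c) hb).1 h) hne
  · exact Or.inr ⟨hc, hb, h⟩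

theorem agent_vote {I : Market m n} {f g : Fin m → Option (Fin n)}
    (hf : ∀ a b, f a = some b → I.Edge a b) (hg : ∀ a b, g a = some b → I.Edge a b) (a : Fin m) :
    vote (I.Above a) (g a) (f a) = (if I.AgentPrefers (edgesOf g) (edgesOf f) a then 1 else 0) -
      (if I.AgentPrefers (edgesOf f) (edgesOf g) a then 1 else 0) := by
  unfold Market.AgentPrefers
  simp only [mem_edgesOf]
  cases hga : g a with
  | none => cases hfa : f a <;> simp [vote]
  | some b =>
    cases hfa : f a with
    | none => simp [vote]
    | some c =>
      simp only [vote, Option.some.injEq, exists_eq_left', forall_eq']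
      have hb := hg a b hga
      have hc := hf a c hfa
      by_cases hbc : b = c
      · subst hbc
        simp
      · rcases Market.above_total hb hc hbc with h | h <;>
          simp [hbc, h, Market.not_above_symm h]

theorem job_vote (f g : Fin m → Option (Fin n)) (b : Fin n) :
    (open Classical in
      (if ∃ a, g a = some b then (1 : ℤ) else 0) - (if ∃ a, f a = some b then 1 else 0)) =
    (if Market.JobPrefers (edgesOf g) (edgesOf f) b then 1 else 0) -
      (if Market.JobPrefers (edgesOf f) (edgesOf g) b then 1 else 0) := by
  unfold Market.JobPrefers
  simp only [mem_edgesOf]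
  by_cases h1 : ∃ a, g a = some b <;> by_cases h2 : ∃ a, f a = some b <;> simp [h1, h2]

/-- Job votes add up to the number of jobs covered by g minus that covered by f. Both numbers can be
charged to the matched agents, which makes the margin separable over agents. -/
theorem votes_sub_votes {I : Market m n} {f g : Fin m → Option (Fin n)}
    (hf : I.IsMatching (edgesOf f)) (hg : I.IsMatching (edgesOf g)) :
    (I.votes (edgesOf g) (edgesOf f) : ℤ) - I.votes (edgesOf f) (edgesOf g) =
      ∑ a, (vote (I.Above a) (g a) (f a) + weightOf (g a) - weightOf (f a)) := by
  classical
  rw [isMatching_edgesOf] at hf hg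
  have hw : ∀ g : Fin m → Option (Fin n), ∀ a, weightOf (g a) = (g a).elim 0 fun _ => 1 := by
    intro g a; cases g a <;> rfl
  unfold Market.votes
  push_cast
  rw [Finset.sum_sub_distrib, Finset.sum_add_distrib]
  simp_rw [hw]
  rw [sum_covered g hg.2, sum_covered f hf.2]
  simp_rw [agent_vote hf.1 hg.1]
  have hj := Finset.sum_congr (rfl : Finset.univ = Finset.univ) fun b _ => job_vote f g b
  simp only [Finset.sum_sub_distrib] at hj ⊢
  simp only [Finset.card_filter, Nat.cast_sum, Nat.cast_ite, Nat.cast_one, Nat.cast_zero]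
  linarith

/-- The preference of an agent for `b` over `c` in one of the two instances. -/
def Either (I J : Market m n) (a : Fin m) (b c : Fin n) : Prop := I.Above a b c ∨ J.Above a b c

/-- The levels `π` certify that the assignment `f` is popular in both instances. -/
structure Certifies (I J : Market m n) (f : Fin m → Option (Fin n)) (π : Fin n → ℕ) : Prop where
  le_two : ∀ b, π b ≤ 2
  inj : InjAssign f
  edge : ∀ a b, f a = some b → I.Edge a b
  up : ∀ a b, f a = some b → ∀ c, I.Edge a c → c ≠ b → Either I J a c b → π b < π c
  down : ∀ a b, f a = some b → ∀ c, I.Edge a c → c ≠ b → π b ≤ π c + 1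
  free : ∀ a, f a = none → ∀ c, I.Edge a c → 2 ≤ π c
  cover : ∀ b, π b ≠ 0 → ∃ a, f a = some b

/-- Weak duality: the contribution of an agent is at most the level of her new job minus that of her
old one, with level 0 for no job. Summed up, this is the level of the jobs covered by g minus that
of the jobs covered by f, and f covers every job of positive level. -/
theorem Certifies.isPopular {I J K : Market m n} {f : Fin m → Option (Fin n)} {π : Fin n → ℕ}
    (h : Certifies I J f π) (hE : ∀ a b, I.Edge a b ↔ K.Edge a b)
    (hK : ∀ a b c, K.Above a b c → Either I J a b c) : K.IsPopular (edgesOf f) := by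
  classical
  have hf : K.IsMatching (edgesOf f) :=
    isMatching_edgesOf.2 ⟨fun a b hab => (hE a b).1 (h.edge a b hab), h.inj⟩
  refine ⟨hf, fun N hN => ?_⟩
  obtain ⟨g, rfl⟩ := exists_eq_edgesOf hN
  have hd := votes_sub_votes hf hN
  rw [isMatching_edgesOf] at hf hN
  suffices ∑ a, (vote (K.Above a) (g a) (f a) + weightOf (g a) - weightOf (f a)) ≤ 0 by
    omega
  have hterm : ∀ a, vote (K.Above a) (g a) (f a) + weightOf (g a) - weightOf (f a) ≤
      (g a).elim 0 (fun b => (π b : ℤ)) - (f a).elim 0 (fun b => (π b : ℤ)) := by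
    intro a
    cases hga : g a with
    | none =>
      cases hfa : f a with
      | none => simp [vote, weightOf]
      | some c =>
        have := h.le_two c
        simp [vote, weightOf]; omega
    | some b =>
      have hb := (hE a b).2 (hN.1 a b hga)
      cases hfa : f a with
      | none =>
        have := h.free a hfa b hb
        simp [vote, weightOf]; omega
      | some c =>
        have hc := h.edge a c hfa
        by_cases hbc : b = c
        · simp [vote, weightOf, hbc]
        · have h1 := h.down a c hfa b hb hbc
          by_cases hab : K.Above a b c
          · have h2 := h.up a c hfa b hb hbc (hK _ _ _ hab)
            simp [vote, weightOf, hbc, hab]; omega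
          · simp [vote, weightOf, hbc, hab]; omega
  refine (Finset.sum_le_sum fun a _ => hterm a).trans ?_
  rw [Finset.sum_sub_distrib, sum_covered g hN.2, sum_covered f hf.2, ← Finset.sum_sub_distrib]
  refine Finset.sum_nonpos fun b _ => ?_
  by_cases hb : π b = 0
  · simp [hb]
  · have := h.cover b hb
    rw [if_pos this]
    split_ifs <;> simp

theorem Certifies.isRobustPopular {I J : Market m n} {f : Fin m → Option (Fin n)} {π : Fin n → ℕ}
    (h : Certifies I J f π) (hE : ∀ a b, I.Edge a b ↔ J.Edge a b) :
    I.IsRobustPopular J (edgesOf f) :=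
  ⟨h.isPopular (fun _ _ => Iff.rfl) fun _ _ _ => Or.inl, h.isPopular hE fun _ _ _ => Or.inr⟩

/-- The merged vote of the exceptional agent is the larger of her two votes, hence one of them; for
all others the three votes coincide. With two exceptional agents the maxima could come from
different instances. -/
theorem sum_vote_either {I J : Market m n} (hIJ : I.DifferInOneAgent J)
    (f g : Fin m → Option (Fin n)) :
    ∑ a, vote (Either I J a) (g a) (f a) = ∑ a, vote (I.Above a) (g a) (f a) ∨
      ∑ a, vote (Either I J a) (g a) (f a) = ∑ a, vote (J.Above a) (g a) (f a) := by
  obtain ⟨-, a₀, ha₀⟩ := hIJ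
  have hsame : ∀ x, x ≠ a₀ → J.Above x = I.Above x := by
    intro x hx
    unfold Market.Above Market.Edge
    rw [ha₀ x hx]
  have hx : ∀ x, x ≠ a₀ → Either I J x = I.Above x := by
    intro x hx
    unfold Either
    rw [hsame x hx]; simp
  have hcase : vote (Either I J a₀) (g a₀) (f a₀) = vote (I.Above a₀) (g a₀) (f a₀) ∨
      vote (Either I J a₀) (g a₀) (f a₀) = vote (J.Above a₀) (g a₀) (f a₀) := by
    cases g a₀ <;> cases f a₀
    · simp [vote]
    · simp [vote]
    · simp [vote]
    · rename_i b c
      by_cases h1 : I.Above a₀ b c <;> by_cases h2 : J.Above a₀ b c <;>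
        simp [vote, Either, h1, h2]
  rcases hcase with h | h
  · left
    refine Finset.sum_congr rfl fun x _ => ?_
    by_cases hxa : x = a₀
    · rw [hxa, h]
    · rw [hx x hxa]
  · right
    refine Finset.sum_congr rfl fun x _ => ?_
    by_cases hxa : x = a₀
    · rw [hxa, h]
    · rw [hx x hxa, hsame x hxa]

/-- The job of a slot; the slots are the jobs and one outside option for each agent. -/
def slotJob : Fin n ⊕ Fin m → Option (Fin n)
  | .inl b => some b
  | .inr _ => none

/-- The slot of an agent under an assignment. -/
def slotOf (f : Fin m → Option (Fin n)) (a : Fin m) : Fin n ⊕ Fin m :=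
  (f a).elim (.inr a) .inl

theorem slotJob_slotOf (f : Fin m → Option (Fin n)) (a : Fin m) : slotJob (slotOf f a) = f a := by
  unfold slotOf; cases f a <;> rfl

theorem slotOf_injective {f : Fin m → Option (Fin n)} (hf : InjAssign f) :
    Function.Injective (slotOf f) := by
  intro a a' h
  unfold slotOf at h
  cases hfa : f a <;> cases hfa' : f a' <;> simp [hfa, hfa'] at h
  · exact h
  · subst h; exact hf _ _ _ hfa hfa'

/-- Strong duality: a permutation of the slots along arcs describes a rival matching and its weight
is the merged margin, which is not positive. The resulting potential, normalised at an unheld slot,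
gives the levels. -/
theorem exists_certifies {I J : Market m n} (hIJ : I.DifferInOneAgent J)
    {f : Fin m → Option (Fin n)} (hf : I.IsRobustPopular J (edgesOf f)) :
    ∃ π, Certifies I J f π := by
  classical
  have hM := hf.1.1
  have hM' := isMatching_edgesOf.1 hM
  have hFinj := slotOf_injective hM'.2
  set F := slotOf f with hF
  -- Arcs out of a held slot lead to what its holder may take instead. Out of an unheld slot the
  -- condition is vacuous, so every arc is present, with weight zero.
  let r : Fin n ⊕ Fin m → Fin n ⊕ Fin m → Prop := fun s s' => ∀ a, F a = s →
    (∀ b, s' = .inl b → I.Edge a b) ∧ ∀ a', s' = .inr a' → a' = a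
  let w : Fin n ⊕ Fin m → Fin n ⊕ Fin m → ℤ := fun s s' =>
    if h : ∃ a, F a = s then
      vote (Either I J h.choose) (slotJob s') (slotJob s) + weightOf (slotJob s')
        - weightOf (slotJob s)
    else 0
  have hw : ∀ a s', w (F a) s' = vote (Either I J a) (slotJob s') (f a)
      + weightOf (slotJob s') - weightOf (f a) := by
    intro a s'
    have hex : ∃ a', F a' = F a := ⟨a, rfl⟩
    simp only [w, dif_pos hex]
    rw [hFinj hex.choose_spec, hF, slotJob_slotOf]
  have hw0 : ∀ s s', (¬ ∃ a, F a = s) → w s s' = 0 := fun s s' h => dif_neg h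
  obtain ⟨p, hp⟩ := exists_potential r w (by
    intro σ hσ
    let g : Fin m → Option (Fin n) := fun a => slotJob (σ (F a))
    have hgN : I.IsMatching (edgesOf g) := by
      rw [isMatching_edgesOf]
      constructor
      · intro a b hab
        rcases hσ (F a) with h | h
        · simp only [g, h] at hab
          rw [hF, slotJob_slotOf] at hab
          exact hM'.1 a b hab
        · refine (h a rfl).1 b ?_
          simp only [g] at hab
          cases hs : σ (F a) with
          | inl x => rw [hs] at hab; simp [slotJob] at hab; rw [hab]
          | inr x => rw [hs] at hab; simp [slotJob] at hab
      · intro a a' b hab hab'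
        have key : ∀ a, g a = some b → σ (F a) = .inl b := by
          intro a hab
          simp only [g] at hab
          cases hs : σ (F a) with
          | inl x => rw [hs] at hab; simp [slotJob] at hab; rw [hab]
          | inr x => rw [hs] at hab; simp [slotJob] at hab
        exact hFinj (σ.injective ((key a hab).trans (key a' hab').symm))
    have hgJ : J.IsMatching (edgesOf g) := by
      rw [isMatching_edgesOf] at hgN ⊢
      exact ⟨fun a b h => (hIJ.1 a b).1 (hgN.1 a b h), hgN.2⟩
    have hI := hf.1.2 _ hgN
    have hJ := hf.2.2 _ hgJ
    have hI' := votes_sub_votes hM hgN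
    have hJ' := votes_sub_votes hf.2.1 hgJ
    have hsum : ∑ v, (if σ v = v then 0 else w v (σ v)) =
        ∑ a, (vote (Either I J a) (g a) (f a) + weightOf (g a) - weightOf (f a)) := by
      rw [← Finset.sum_subset (Finset.subset_univ (Finset.univ.image F)),
        Finset.sum_image fun a _ a' _ h => hFinj h]
      · refine Finset.sum_congr rfl fun a _ => ?_
        split_ifs with h
        · have : g a = f a := by simp only [g, h]; rw [hF, slotJob_slotOf]
          rw [this]
          cases f a <;> simp [vote]
        · exact hw a _
      · intro s _ hs
        split_ifs
        · rfl
        · exact hw0 s _ fun ⟨a, ha⟩ => hs (Finset.mem_image.2 ⟨a, Finset.mem_univ _, ha⟩)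
    rw [hsum]
    rw [Finset.sum_sub_distrib, Finset.sum_add_distrib] at hI' hJ' ⊢
    rcases sum_vote_either hIJ f g with h | h <;> rw [h] <;> omega)
  by_cases hu : ∃ u, ¬ ∃ a, F a = u
  · obtain ⟨u, hu⟩ := hu
    -- The zero-weight arcs out of unheld slots force these to share the minimal potential, which
    -- becomes level 0. So jobs of positive level are held.
    have hr : ∀ s s', (¬ ∃ a, F a = s) → r s s' := fun s s' h a ha => absurd ⟨a, ha⟩ h
    have hmin : ∀ s, p u ≤ p s := by
      intro s
      by_cases hus : u = s
      · rw [hus]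
      · have := hp u s (hr u s hu) hus
        rw [hw0 u s hu] at this; linarith
    have hzero : ∀ s, (¬ ∃ a, F a = s) → p s = p u := by
      intro s hs
      refine le_antisymm ?_ (hmin s)
      by_cases hus : s = u
      · rw [hus]
      · have := hp s u (hr s u hs) hus
        rw [hw0 s u hs] at this; linarith
    have hcast : ∀ b, (((p (.inl b) - p u).toNat : ℕ) : ℤ) = p (.inl b) - p u := fun b =>
      Int.toNat_of_nonneg (sub_nonneg.2 (hmin _))
    have hjob : ∀ a b, f a = some b → F a = .inl b := by
      intro a b h; simp [hF, slotOf, h]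
    have hnone : ∀ a, f a = none → F a = .inr a := by
      intro a h; simp [hF, slotOf, h]
    have hcov : ∀ b, (p (.inl b) - p u).toNat ≠ 0 → ∃ a, f a = some b := by
      intro b hb
      by_contra hcon
      apply hb
      rw [hzero (.inl b)]
      · simp
      · rintro ⟨a, ha⟩
        refine hcon ⟨a, ?_⟩
        rw [← slotJob_slotOf f, ← hF, ha]; rfl
    have hstep : ∀ a b, f a = some b → ∀ c, I.Edge a c → c ≠ b →
        p (.inl b) + (if Either I J a c b then 1 else -1) ≤ p (.inl c) := by
      intro a b hab c hac hcb
      have hrr : r (F a) (.inl c) := by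
        intro a' ha'
        rw [hFinj ha']
        exact ⟨fun b' hb' => by rw [← Sum.inl.inj hb']; exact hac, fun a' h => by simp at h⟩
      have := hp (F a) (.inl c) hrr (by rw [hjob a b hab]; simpa using hcb.symm)
      rw [hw a, hab, hjob a b hab] at this
      simpa [vote, weightOf, slotJob, hcb] using this
    refine ⟨fun b => (p (.inl b) - p u).toNat, ?_, hM'.2, hM'.1, ?_, ?_, ?_, hcov⟩
    · intro b
      by_contra hb
      obtain ⟨a, hab⟩ := hcov b (by omega)
      have hFa := hjob a b hab
      -- Moving to the outside option loses two votes, the agent's and the job's. As her outside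
      -- option is unheld, this arc bounds the level of her job by 2.
      have hrr : r (F a) (.inr a) := by
        intro a' ha'
        rw [hFinj ha']
        exact ⟨fun b' hb' => by simp at hb', fun a' h => by simpa using h.symm⟩
      have h1 := hp (F a) (.inr a) hrr (by rw [hFa]; simp)
      have h2 : p (.inr a) = p u := by
        apply hzero
        rintro ⟨a', ha'⟩
        have : f a' = none := by rw [← slotJob_slotOf f, ← hF, ha']; rfl
        have h3 := hnone a' this
        rw [ha'] at h3
        rw [← Sum.inr.inj h3, hab] at this
        simp at this
      rw [hw a, hab, hFa, h2] at h1
      simp [vote, weightOf, slotJob] at h1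
      have := hcast b
      omega
    · intro a b hab c hac hcb he
      have := hstep a b hab c hac hcb
      rw [if_pos he] at this
      have := hcast b; have := hcast c
      omega
    · intro a b hab c hac hcb
      have := hstep a b hab c hac hcb
      have := hcast b; have := hcast c
      split_ifs at * <;> omega
    · intro a ha c hac
      have hFa := hnone a ha
      have hrr : r (F a) (.inl c) := by
        intro a' ha'
        rw [hFinj ha']
        exact ⟨fun b' hb' => by rw [← Sum.inl.inj hb']; exact hac, fun a' h => by simp at h⟩
      have h1 := hp (F a) (.inl c) hrr (by rw [hFa]; simp)
      rw [hw a, ha, hFa] at h1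
      simp [vote, weightOf, slotJob] at h1
      have := hcast c
      have := hmin (.inr a)
      omega
  · push Not at hu
    -- If m agents hold all n + m slots, there are no jobs and nothing to certify.
    have hcard : Fintype.card (Fin n ⊕ Fin m) ≤ Fintype.card (Fin m) :=
      Fintype.card_le_of_surjective F hu
    have hn : n = 0 := by simpa using hcard
    subst hn
    exact ⟨fun _ => 0, fun b => b.elim0, hM'.2, hM'.1, fun _ b => b.elim0, fun _ b => b.elim0,
      fun _ _ b => b.elim0, fun b => b.elim0⟩

end Popularity

/-! ### The auction: lowering levels and refuting solutions -/

section Auction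

variable {m n : ℕ} {rk : ℕ → ℕ → ℕ}

/-- Agent `a` may use slot `s` at the levels `U`. Row `a` of `rk` holds the ranks of agent `a` in the
first instance and row `m + a` those in the second; rank `0` means that there is no edge. Column
`n + a` belongs to the outside option of agent `a`. -/
def Good (m n : ℕ) (rk : ℕ → ℕ → ℕ) (U : ℕ → ℕ) (a s : ℕ) : Prop :=
  rk a s ≠ 0 ∧ ∀ b < n, rk a b ≠ 0 → b ≠ s →
    if rk a b < rk a s ∨ rk (m + a) b < rk (m + a) s then U s < U b else U s ≤ U b + 1

/-- The properties of rank tables on which the algorithm depends. -/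
structure RankTable (m n : ℕ) (rk : ℕ → ℕ → ℕ) : Prop where
  ne : ∀ a < m, ∀ b < n, ∀ c < n, rk a b ≠ 0 → b ≠ c → rk a b ≠ rk a c
  le : ∀ a < m, ∀ b < n, rk a b ≤ n
  own : ∀ a < m, rk a (n + a) = n + 1
  other : ∀ a < m, ∀ a' < m, a' ≠ a → rk a (n + a') = 0

/-- Jobs have levels at most `2`, outside options have level `1`. -/
structure Levels (m n : ℕ) (U : ℕ → ℕ) : Prop where
  le_two : ∀ b < n, U b ≤ 2
  out : ∀ a < m, U (n + a) = 1

/-- An assignment `f` of slots to agents together with certifying levels `π`. -/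
structure Solution (m n : ℕ) (rk : ℕ → ℕ → ℕ) (f π : ℕ → ℕ) : Prop where
  lev : Levels m n π
  lt : ∀ a < m, f a < n + m
  good : ∀ a < m, Good m n rk π a (f a)
  inj : ∀ a < m, ∀ a' < m, f a = f a' → a = a'
  cover : ∀ b < n, π b ≠ 0 → ∃ a < m, f a = b

/-- The levels `U` bound those of every solution. -/
structure UpperLevels (m n : ℕ) (rk : ℕ → ℕ → ℕ) (U : ℕ → ℕ) : Prop where
  lev : Levels m n U
  bound : ∀ f π, Solution m n rk f π → ∀ b < n, π b ≤ U b

/-- In phase `0` only jobs of positive level are for sale. -/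
def Elig (m n : ℕ) (rk : ℕ → ℕ → ℕ) (U : ℕ → ℕ) (ph a s : ℕ) : Prop :=
  (ph ≠ 0 ∨ s < n ∧ U s ≠ 0) ∧ Good m n rk U a s

/-- The state of the auction: agent `a` holds slot `g a - 1`, slot `s` is held by agent `o s - 1`
and has price `p s`. -/
structure AuctionState (m n : ℕ) (rk : ℕ → ℕ → ℕ) (U : ℕ → ℕ) (ph : ℕ) (g o p : ℕ → ℕ) : Prop where
  go : ∀ a < m, ∀ s < n + m, g a = s + 1 ↔ o s = a + 1
  g_le : ∀ a < m, g a ≤ n + m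
  o_le : ∀ s < n + m, o s ≤ m
  elig : ∀ a < m, ∀ s, g a = s + 1 → Elig m n rk U ph a s
  free : ∀ s < n + m, o s = 0 → p s = 0
  p_le : ∀ s < n + m, p s ≤ m + 2
  slack : ∀ a < m, ∀ s, g a = s + 1 → ∀ s' < n + m, Elig m n rk U ph a s' → p s ≤ p s' + 1
  cover : ph ≠ 0 → ∀ b < n, U b ≠ 0 → o b ≠ 0

/-- No free agent can afford a slot. -/
def NoBid (m n : ℕ) (rk : ℕ → ℕ → ℕ) (U : ℕ → ℕ) (ph : ℕ) (g p : ℕ → ℕ) : Prop :=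
  ∀ a < m, g a = 0 → ∀ s < n + m, Elig m n rk U ph a s → m + 2 ≤ p s

/-- Passing from π to U keeps the left-hand sides of the inequalities and can only increase the
right-hand sides. -/
theorem Good.of_level_eq {U π : ℕ → ℕ} {a s : ℕ} (h : Good m n rk π a s) (hs : π s = U s)
    (hle : ∀ b < n, π b ≤ U b) : Good m n rk U a s := by
  refine ⟨h.1, fun b hb hab hne => ?_⟩
  have := h.2 b hb hab hne
  have := hle b hb
  split_ifs at * <;> omega

theorem Good.slot_cases (hR : RankTable m n rk) {U : ℕ → ℕ} {a s : ℕ} (ha : a < m) (hs : s < n + m)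
    (h : Good m n rk U a s) : s < n ∨ s = n + a := by
  by_contra hcon
  push Not at hcon
  obtain ⟨a', rfl⟩ := Nat.exists_eq_add_of_le hcon.1
  exact h.1 (hR.other a ha a' (by omega) (by omega))

theorem Levels.eq_of_ge {U π : ℕ → ℕ} (hU : Levels m n U) (hπ : Levels m n π) {s : ℕ}
    (hs : n ≤ s) (hs' : s < n + m) : π s = U s := by
  obtain ⟨a, rfl⟩ := Nat.exists_eq_add_of_le hs
  rw [hU.out a (by omega), hπ.out a (by omega)]

/-- Suppose π s' < U s', so that s' is a job. Let s be a job as well. If s' beats s in some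
instance, then U s' ≤ U s + 1 = π s + 1 ≤ π s' < U s'. Otherwise s beats s' because ranks are
strict, and U s' < U s = π s ≤ π s' + 1 ≤ U s'. If s is the outside option, of level 1, then π s' is
already 2, the maximum. -/
theorem level_eq_of_good (hR : RankTable m n rk) {U π : ℕ → ℕ} (hU : Levels m n U)
    (hπ : Levels m n π) (hle : ∀ b < n, π b ≤ U b) {a s s' : ℕ} (ha : a < m) (hs : s < n + m)
    (hs' : s' < n + m) (h : Good m n rk π a s) (heq : π s = U s) (h' : Good m n rk U a s') :
    π s' = U s' := by
  rcases Nat.lt_or_ge s' n with hn | hn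
  · by_contra hne
    have hlt : π s' < U s' := lt_of_le_of_ne (hle s' hn) hne
    have hss : s' ≠ s := by rintro rfl; exact hne heq
    have h1 := h.2 s' hn h'.1 hss
    rcases h.slot_cases hR ha hs with hsn | rfl
    · have h2 := h'.2 s hsn h.1 hss.symm
      have h3 := hR.ne a ha s hsn s' hn h.1 hss.symm
      split_ifs at h1 h2 <;> omega
    · rw [if_pos (Or.inl (by rw [hR.own a ha]; have := hR.le a ha s' hn; omega)),
        hπ.out a ha] at h1
      have := hU.le_two s' hn
      omega
  · exact hU.eq_of_ge hπ hn hs'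

namespace AuctionState

variable {U g o p : ℕ → ℕ} {ph : ℕ}

theorem g_inj (h : AuctionState m n rk U ph g o p) {a a' s : ℕ} (ha : a < m) (ha' : a' < m)
    (hs : g a = s + 1) (hs' : g a' = s + 1) : a = a' := by
  have hsn : s < n + m := by have := h.g_le a ha; omega
  have h1 := (h.go a ha s hsn).1 hs
  have h2 := (h.go a' ha' s hsn).1 hs'
  omega

theorem exists_holder (h : AuctionState m n rk U ph g o p) {s : ℕ} (hs : s < n + m)
    (ho : o s ≠ 0) : ∃ a < m, g a = s + 1 := by
  have := h.o_le s hs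
  exact ⟨o s - 1, by omega, (h.go _ (by omega) s hs).2 (by omega)⟩

/-- A slot of positive price is held and there are at most m holders, so positive prices take at
most m values. -/
theorem exists_price_gap (h : AuctionState m n rk U ph g o p) :
    ∃ j, 1 ≤ j ∧ j ≤ m + 1 ∧ ∀ s < n + m, p s ≠ j := by
  by_contra hcon
  push Not at hcon
  let P := (Finset.range (n + m)).filter fun s => o s ≠ 0
  have h1 : P.card ≤ (Finset.Icc 1 m).card := by
    refine Finset.card_le_card_of_injOn o ?_ ?_
    · intro s hs
      simp [P] at hs ⊢
      exact ⟨by omega, h.o_le s hs.1⟩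
    · intro s hs s' hs' hss
      simp [P] at hs hs'
      obtain ⟨a, ha, hga⟩ := h.exists_holder hs.1 hs.2
      obtain ⟨a', ha', hga'⟩ := h.exists_holder hs'.1 hs'.2
      have e1 := (h.go a ha s hs.1).1 hga
      have e2 := (h.go a' ha' s' hs'.1).1 hga'
      have : a = a' := by omega
      subst this
      omega
  have h2 : Finset.Icc 1 (m + 1) ⊆ P.image p := by
    intro j hj
    rw [Finset.mem_Icc] at hj
    obtain ⟨s, hs, hps⟩ := hcon j hj.1 hj.2
    refine Finset.mem_image.2 ⟨s, ?_, hps⟩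
    simp only [P, Finset.mem_filter, Finset.mem_range]
    refine ⟨hs, fun h0 => ?_⟩
    have := h.free s hs h0
    omega
  have h3 := (Finset.card_le_card h2).trans Finset.card_image_le
  simp at h1 h3
  omega

/-- Without bids there is a price level that separates the slots which are out of reach. -/
theorem exists_threshold (h : AuctionState m n rk U ph g o p) (hno : NoBid m n rk U ph g p) :
    ∃ j, 1 ≤ j ∧ ∀ a < m, (g a = 0 ∨ ∃ s, g a = s + 1 ∧ j < p s) →
      ∀ s < n + m, Elig m n rk U ph a s → j < p s := by
  obtain ⟨j, hj1, hj2, hj⟩ := h.exists_price_gap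
  refine ⟨j, hj1, fun a ha hT s hs he => ?_⟩
  rcases hT with h0 | ⟨s₀, hs₀, hp⟩
  · have := hno a ha h0 s hs he; omega
  -- Slackness allows an eligible slot to be cheaper by at most one, hence to cost at least j; the
  -- value j itself is the gap.
  · have := h.slack a ha s₀ hs₀ s hs he
    have := hj s hs
    omega

/-- Alternating between the solution and the auction maps the cheap positive-level jobs on which π
equals U injectively into themselves, with only jobs held in the auction as values. An uncovered job
has price 0, so if it met its bound it would be such a job without a preimage. -/
theorem lt_level_of_uncovered (h : AuctionState m n rk U ph g o p) (hR : RankTable m n rk)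
    (hU : UpperLevels m n rk U) (hno : NoBid m n rk U ph g p) {f π : ℕ → ℕ}
    (hf : Solution m n rk f π) {b : ℕ} (hb : b < n) (hUb : U b ≠ 0) (hob : o b = 0) :
    π b < U b := by
  have hle := hU.bound f π hf
  refine lt_of_le_of_ne (hle b hb) fun heq => ?_
  have hph : ph = 0 := by
    by_contra hph
    exact h.cover hph b hb hUb hob
  obtain ⟨j, hj1, hj⟩ := h.exists_threshold hno
  let Q := (Finset.range n).filter fun s => π s = U s ∧ U s ≠ 0 ∧ p s ≤ j
  have hstep : ∀ s ∈ Q, ∃ a < m, f a = s ∧ ∃ s' ∈ Q, g a = s' + 1 := by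
    intro s hs
    simp only [Q, Finset.mem_filter, Finset.mem_range] at hs ⊢
    obtain ⟨hsn, hπ, hUs, hps⟩ := hs
    obtain ⟨a, ha, hfa⟩ := hf.cover s hsn (by omega)
    -- The holder a of s in the solution finds s cheap, so by the threshold she holds a cheap slot
    -- s' in the auction; `level_eq_of_good` shows that π equals U there too.
    have hgood := hf.good a ha
    rw [hfa] at hgood
    have hel : Elig m n rk U ph a s := ⟨Or.inr ⟨hsn, hUs⟩, hgood.of_level_eq hπ hle⟩
    have hnT : ¬ (g a = 0 ∨ ∃ s, g a = s + 1 ∧ j < p s) := fun hT => by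
      have := hj a ha hT s (by omega) hel
      omega
    push Not at hnT
    obtain ⟨s', hs'⟩ := Nat.exists_eq_add_one_of_ne_zero hnT.1
    have hel' := h.elig a ha s' hs'
    have hs'n : s' < n ∧ U s' ≠ 0 := by
      rcases hel'.1 with h1 | h1
      · exact absurd hph h1
      · exact h1
    exact ⟨a, ha, hfa, s', ⟨hs'n.1, level_eq_of_good hR hU.lev hf.lev hle ha (s := s) (by omega)
      (by omega) hgood hπ hel'.2, hs'n.2, hnT.2 s' hs'⟩, hs'⟩
  choose! e he hfe t ht hgt using hstep
  have hinj : Set.InjOn t Q := by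
    intro s hs s' hs' hss
    have h1 := hgt s hs
    have h2 := hgt s' hs'
    rw [← hss] at h2
    have := h.g_inj (he s hs) (he s' hs') h1 h2
    rw [← hfe s hs, ← hfe s' hs', this]
  have hsurj : Q.image t = Q :=
    Finset.eq_of_subset_of_card_le (Finset.image_subset_iff.2 ht)
      (Finset.card_image_of_injOn hinj).ge
  have hbQ : b ∈ Q := by
    simp only [Q, Finset.mem_filter, Finset.mem_range]
    have := h.free b (by omega) hob
    exact ⟨hb, heq, hUb, by omega⟩
  rw [← hsurj] at hbQ
  obtain ⟨s, hs, hts⟩ := Finset.mem_image.1 hbQ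
  have h1 := hgt s hs
  rw [hts] at h1
  have := (h.go _ (he s hs) b (by omega)).1 h1
  omega

/-- Jobs where π differs from U have positive bound, hence are held in the auction; counting shows
that auction and solution give them to the same set of agents. Among the remaining agents, start
from a free one: her slot in the solution is expensive, so it is held by another agent of the same
kind. This shift is an injection of a finite set that misses the free agent. -/
theorem not_solution_of_free (h : AuctionState m n rk U ph g o p) (hR : RankTable m n rk)
    (hU : UpperLevels m n rk U) (hno : NoBid m n rk U ph g p) (hph : ph ≠ 0) {a₀ : ℕ}
    (ha₀ : a₀ < m) (hg₀ : g a₀ = 0) {f π : ℕ → ℕ} (hf : Solution m n rk f π) : False := by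
  classical
  have hle := hU.bound f π hf
  obtain ⟨j, hj1, hj⟩ := h.exists_threshold hno
  let N := (Finset.range n).filter fun s => π s ≠ U s
  have hmemN : ∀ s < n + m, π s ≠ U s → s ∈ N := by
    intro s hs hne
    simp only [N, Finset.mem_filter, Finset.mem_range]
    refine ⟨?_, hne⟩
    by_contra hn
    exact hne (hU.lev.eq_of_ge hf.lev (by omega) hs)
  have hstep : ∀ s ∈ N, ∃ a < m, g a = s + 1 ∧ f a ∈ N := by
    intro s hs
    simp only [N, Finset.mem_filter, Finset.mem_range] at hs
    have h1 := hle s hs.1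
    obtain ⟨a, ha, hga⟩ := h.exists_holder (s := s) (by omega) (h.cover hph s hs.1 (by omega))
    refine ⟨a, ha, hga, hmemN _ (hf.lt a ha) fun heq => hs.2 ?_⟩
    exact level_eq_of_good hR hU.lev hf.lev hle ha (hf.lt a ha) (by omega) (hf.good a ha) heq
      (h.elig a ha s hga).2
  choose! e he hge hfe using hstep
  have hsurj : N.image (fun s => f (e s)) = N := by
    refine Finset.eq_of_subset_of_card_le (Finset.image_subset_iff.2 hfe)
      (Finset.card_image_of_injOn ?_).ge
    intro s hs s' hs' hss
    have h1 := hf.inj _ (he s hs) _ (he s' hs') hss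
    have h2 := hge s hs
    rw [h1, hge s' hs'] at h2
    omega
  have hback : ∀ a < m, f a ∈ N → ∃ s ∈ N, g a = s + 1 := by
    intro a ha hfa
    rw [← hsurj] at hfa
    obtain ⟨s, hs, hss⟩ := Finset.mem_image.1 hfa
    have := hf.inj _ (he s hs) _ ha hss
    exact ⟨s, hs, by rw [← this]; exact hge s hs⟩
  -- Agents who are out of reach of cheap slots and whose slot in the solution has level equal to
  -- the bound.
  let T := (Finset.range m).filter fun a =>
    f a ∉ N ∧ (g a = 0 ∨ ∃ s, g a = s + 1 ∧ j < p s)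
  have hT : ∀ a ∈ T, ∃ a' ∈ T, g a' = f a + 1 := by
    intro a ha
    simp only [T, Finset.mem_filter, Finset.mem_range] at ha ⊢
    obtain ⟨ha, hfa, hTa⟩ := ha
    have hD : π (f a) = U (f a) := by
      by_contra hne
      exact hfa (hmemN _ (hf.lt a ha) hne)
    have hp := hj a ha hTa (f a) (hf.lt a ha) ⟨Or.inl hph, (hf.good a ha).of_level_eq hD hle⟩
    obtain ⟨a', ha', hga'⟩ := h.exists_holder (hf.lt a ha) fun h0 => by
      have := h.free _ (hf.lt a ha) h0
      omega
    refine ⟨a', ⟨ha', fun hN => ?_, Or.inr ⟨f a, hga', hp⟩⟩, hga'⟩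
    obtain ⟨s, hs, hgs⟩ := hback a' ha' hN
    have : s = f a := by omega
    exact hfa (this ▸ hs)
  choose! t ht hgt using hT
  have hTim : T.image t = T := by
    refine Finset.eq_of_subset_of_card_le (Finset.image_subset_iff.2 ht)
      (Finset.card_image_of_injOn ?_).ge
    intro a ha a' ha' haa
    have h1 := hgt a ha
    have h2 := hgt a' ha'
    rw [haa] at h1
    have hm : ∀ x ∈ (T : Set ℕ), x < m := fun x hx => by simp [T] at hx; exact hx.1
    exact hf.inj a (hm a ha) a' (hm a' ha') (by omega)
  have ha₀T : a₀ ∈ T := by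
    simp only [T, Finset.mem_filter, Finset.mem_range]
    refine ⟨ha₀, fun hN => ?_, Or.inl hg₀⟩
    obtain ⟨s, -, hgs⟩ := hback a₀ ha₀ hN
    omega
  rw [← hTim] at ha₀T
  obtain ⟨a, ha, hta⟩ := Finset.mem_image.1 ha₀T
  have := hgt a ha
  rw [hta] at this
  omega

theorem solution (h : AuctionState m n rk U ph g o p) (hU : Levels m n U) (hph : ph ≠ 0)
    (hall : ∀ a < m, g a ≠ 0) : Solution m n rk (fun a => g a - 1) U where
  lev := hU
  lt a ha := by have := h.g_le a ha; have := hall a ha; omega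
  good a ha := (h.elig a ha _ (by have := hall a ha; omega)).2
  inj a ha a' ha' haa := by
    have h1 := hall a ha
    have h2 := hall a' ha'
    exact h.g_inj (s := g a - 1) ha ha' (by omega) (by omega)
  cover b hb hUb := by
    obtain ⟨a, ha, hga⟩ := h.exists_holder (s := b) (by omega) (h.cover hph b hb hUb)
    exact ⟨a, ha, by simp [hga]⟩

theorem reset (U : ℕ → ℕ) {g o p : ℕ → ℕ} (hg : ∀ a < m, g a = 0) (ho : ∀ s < n + m, o s = 0)
    (hp : ∀ s < n + m, p s = 0) : AuctionState m n rk U 0 g o p where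
  go a ha s hs := by rw [hg a ha, ho s hs]; omega
  g_le a ha := by rw [hg a ha]; omega
  o_le s hs := by rw [ho s hs]; omega
  elig a ha s h := by rw [hg a ha] at h; omega
  free s hs _ := hp s hs
  p_le s hs := by rw [hp s hs]; omega
  slack a ha s h := by rw [hg a ha] at h; omega
  cover h := absurd rfl h

/-- The second phase only relaxes eligibility, so the holdings remain valid; the new slots were not
priced, and zero prices restore slackness. -/
theorem next_phase (h : AuctionState m n rk U ph g o p) (hcov : ∀ b < n, U b ≠ 0 → o b ≠ 0)
    {p' : ℕ → ℕ} (hp : ∀ s < n + m, p' s = 0) : AuctionState m n rk U 1 g o p' where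
  go := h.go
  g_le := h.g_le
  o_le := h.o_le
  elig a ha s hs := ⟨Or.inl one_ne_zero, (h.elig a ha s hs).2⟩
  free s hs _ := hp s hs
  p_le s hs := by rw [hp s hs]; omega
  slack a ha s hs s' _ _ := by rw [hp s (by have := h.g_le a ha; omega)]; omega
  cover _ := hcov

/-- The bidder chooses a cheapest eligible slot, so after the increase she still satisfies
slackness; the others do because prices never fall during bidding. A slot once held stays held,
though its holder may change. -/
theorem bid (h : AuctionState m n rk U ph g o p) {a₀ s₀ : ℕ} (ha₀ : a₀ < m) (hs₀ : s₀ < n + m)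
    (hg₀ : g a₀ = 0) (he : Elig m n rk U ph a₀ s₀) (hp : p s₀ < m + 2)
    (hmin : ∀ s < n + m, Elig m n rk U ph a₀ s → p s₀ ≤ p s) :
    AuctionState m n rk U ph
      (fun a => if a = a₀ then s₀ + 1 else if o s₀ = a + 1 then 0 else g a)
      (Function.update o s₀ (a₀ + 1)) (Function.update p s₀ (p s₀ + 1)) where
  go a ha s hs := by
    have h1 := h.go a ha s hs
    have h2 := h.go a ha s₀ hs₀
    by_cases haa : a = a₀ <;> by_cases hss : s = s₀
    · subst haa hss; simp
    · subst haa
      rw [if_pos rfl, Function.update_of_ne hss]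
      constructor
      · intro h3; omega
      · intro h3
        have := h1.2 h3
        omega
    · subst hss
      rw [if_neg haa, Function.update_self]
      split_ifs with h3
      · constructor
        · intro h4; exact h4.elim
        · intro h4; omega
      · constructor
        · intro h4; exact absurd (h2.1 h4) h3
        · intro h4; omega
    · rw [if_neg haa, Function.update_of_ne hss]
      split_ifs with h3
      · have := h2.2 h3
        constructor
        · intro h4; exact h4.elim
        · intro h4
          have := h1.2 h4
          omega
      · exact h1
  g_le a ha := by
    have := h.g_le a ha
    split_ifs <;> omega
  o_le s hs := by
    have := h.o_le s hs
    by_cases hss : s = s₀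
    · subst hss; rw [Function.update_self]; omega
    · rw [Function.update_of_ne hss]; exact this
  elig a ha s hs := by
    split_ifs at hs with h1 h2
    · obtain rfl : s₀ = s := by omega
      rw [h1]; exact he
    · exact h.elig a ha s hs
  free s hs ho := by
    by_cases hss : s = s₀
    · subst hss; rw [Function.update_self] at ho; omega
    · rw [Function.update_of_ne hss] at ho ⊢
      exact h.free s hs ho
  p_le s hs := by
    by_cases hss : s = s₀
    · subst hss; rw [Function.update_self]; omega
    · rw [Function.update_of_ne hss]; exact h.p_le s hs
  slack a ha s hs s' hs' he' := by
    have hmono : p s' ≤ Function.update p s₀ (p s₀ + 1) s' := by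
      by_cases hss : s' = s₀
      · subst hss; rw [Function.update_self]; omega
      · rw [Function.update_of_ne hss]
    split_ifs at hs with h1 h2
    · obtain rfl : s₀ = s := by omega
      subst h1
      have := hmin s' hs' he'
      rw [Function.update_self]
      omega
    · have hss : s ≠ s₀ := by
        rintro rfl
        exact h2 ((h.go a ha s hs₀).1 hs)
      rw [Function.update_of_ne hss]
      have := h.slack a ha s hs s' hs' he'
      omega
  cover hph b hb hUb := by
    by_cases hss : b = s₀
    · subst hss; rw [Function.update_self]; omega
    · rw [Function.update_of_ne hss]; exact h.cover hph b hb hUb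

end AuctionState

theorem UpperLevels.lower {U g o p : ℕ → ℕ} {ph : ℕ} (hU : UpperLevels m n rk U)
    (h : AuctionState m n rk U ph g o p) (hR : RankTable m n rk) (hno : NoBid m n rk U ph g p) :
    UpperLevels m n rk fun b => if b < n ∧ o b = 0 then U b - 1 else U b where
  lev :=
    { le_two := fun b hb => by
        have := hU.lev.le_two b hb
        split_ifs <;> omega
      out := fun a ha => by
        rw [if_neg (by omega)]
        exact hU.lev.out a ha }
  bound f π hf b hb := by
    have h1 := hU.bound f π hf b hb
    split_ifs with ho
    · by_cases hUb : U b = 0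
      · omega
      · have := h.lt_level_of_uncovered hR hU hno hf hb hUb ho.2
        omega
    · exact h1

theorem UpperLevels.initial {U : ℕ → ℕ} (h : ∀ b < n, U b = 2) (h' : ∀ a < m, U (n + a) = 1) :
    UpperLevels m n rk U where
  lev := ⟨fun b hb => (h b hb).le, h'⟩
  bound f π hf b hb := by rw [h b hb]; exact hf.lev.le_two b hb

end Auction

/-! ### From markets to rank tables -/

section Bridge

variable {m n : ℕ}

/-- The preference lists of the first instance followed by those of the second. -/
def rowList (I J : Market m n) (x : ℕ) : List ℕ :=
  if h : x < m then (I.list ⟨x, h⟩).map Fin.val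
  else if h : x - m < m then (J.list ⟨x - m, h⟩).map Fin.val else []

/-- The agent of a row. -/
def rowAgent (m x : ℕ) : ℕ := if x < m then x else x - m

/-- The ranks of the jobs in the rows, and of the outside options. -/
def rankOf (I J : Market m n) (x c : ℕ) : ℕ :=
  if c < n then if c ∈ rowList I J x then (rowList I J x).idxOf c + 1 else 0
  else if c = n + rowAgent m x then n + 1 else 0

theorem idxOf_map_val (l : List (Fin n)) (b : Fin n) :
    (l.map Fin.val).idxOf b.val = l.idxOf b := by
  induction l with
  | nil => simp
  | cons x l ih =>
    rw [List.map_cons, List.idxOf_cons, List.idxOf_cons, ih]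
    by_cases h : x = b
    · subst h; simp
    · have : x.val ≠ b.val := fun h' => h (Fin.ext h')
      rw [beq_false_of_ne h, beq_false_of_ne this]

theorem rowList_fst (I J : Market m n) (a : Fin m) :
    rowList I J a = (I.list a).map Fin.val := by simp [rowList]

theorem rowList_snd (I J : Market m n) (a : Fin m) :
    rowList I J (m + a) = (J.list a).map Fin.val := by simp [rowList]

theorem mem_rowList_lt (I J : Market m n) (x : ℕ) {c : ℕ} (hc : c ∈ rowList I J x) : c < n := by
  unfold rowList at hc
  split_ifs at hc
  · obtain ⟨b, -, rfl⟩ := List.mem_map.1 hc; exact b.2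
  · obtain ⟨b, -, rfl⟩ := List.mem_map.1 hc; exact b.2
  · simp at hc

theorem nodup_rowList (I J : Market m n) (x : ℕ) : (rowList I J x).Nodup := by
  unfold rowList
  split_ifs
  · exact (I.nodup _).map Fin.val_injective
  · exact (J.nodup _).map Fin.val_injective
  · simp

theorem length_rowList_le (I J : Market m n) (x : ℕ) : (rowList I J x).length ≤ n := by
  rw [← List.toFinset_card_of_nodup (nodup_rowList I J x)]
  calc _ ≤ (Finset.range n).card := Finset.card_le_card fun c hc =>
        Finset.mem_range.2 (mem_rowList_lt I J x (List.mem_toFinset.1 hc))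
    _ = n := by simp

theorem rankOf_fst (I J : Market m n) (a : Fin m) (b : Fin n) :
    rankOf I J a b = if I.Edge a b then (I.list a).idxOf b + 1 else 0 := by
  have : ((b : ℕ) ∈ (I.list a).map Fin.val) ↔ I.Edge a b := by simp [Market.Edge, Fin.val_inj]
  unfold rankOf
  rw [if_pos b.2, rowList_fst, idxOf_map_val]
  simp only [this]

theorem rankOf_snd (I J : Market m n) (a : Fin m) (b : Fin n) :
    rankOf I J (m + a) b = if J.Edge a b then (J.list a).idxOf b + 1 else 0 := by
  have : ((b : ℕ) ∈ (J.list a).map Fin.val) ↔ J.Edge a b := by simp [Market.Edge, Fin.val_inj]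
  unfold rankOf
  rw [if_pos b.2, rowList_snd, idxOf_map_val]
  simp only [this]

theorem rankOf_le (I J : Market m n) (x : ℕ) {c : ℕ} (hc : c < n) : rankOf I J x c ≤ n := by
  unfold rankOf
  rw [if_pos hc]
  split_ifs with h
  · have := List.idxOf_lt_length_of_mem h
    have := length_rowList_le I J x
    omega
  · omega

theorem rankTable_rankOf (I J : Market m n) : RankTable m n (rankOf I J) where
  ne a ha b hb c hc h hne := by
    have e1 := rankOf_fst I J ⟨a, ha⟩ ⟨b, hb⟩
    have e2 := rankOf_fst I J ⟨a, ha⟩ ⟨c, hc⟩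
    simp only at e1 e2
    rw [e1] at h
    rw [e1, e2]
    split_ifs with h1 h2
    · intro heq
      have := (List.idxOf_inj (x := (⟨b, hb⟩ : Fin n)) (y := ⟨c, hc⟩) h1).1 (by omega)
      exact hne (by simpa using this)
    · omega
    · rw [if_neg h1] at h; omega
    · rw [if_neg h1] at h; omega
  le a _ b hb := rankOf_le I J a hb
  own a ha := by simp [rankOf, rowAgent, ha]
  other a ha a' _ hne := by simp [rankOf, rowAgent, ha, hne]

theorem rankOf_fst_ne_zero {I J : Market m n} {a : Fin m} {b : Fin n} :
    rankOf I J a b ≠ 0 ↔ I.Edge a b := by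
  rw [rankOf_fst]; split_ifs with h <;> simp [h]

theorem either_iff_rankOf {I J : Market m n} (hE : ∀ a b, I.Edge a b ↔ J.Edge a b) {a : Fin m}
    {b c : Fin n} (hb : I.Edge a b) (hc : I.Edge a c) :
    Either I J a c b ↔ rankOf I J a c < rankOf I J a b ∨
      rankOf I J (m + a) c < rankOf I J (m + a) b := by
  have hb' := (hE a b).1 hb
  have hc' := (hE a c).1 hc
  rw [rankOf_fst, rankOf_fst, rankOf_snd, rankOf_snd]
  simp [Either, Market.Above, hb, hc, hb', hc']

theorem good_job_iff {I J : Market m n} (hE : ∀ a b, I.Edge a b ↔ J.Edge a b) (U : ℕ → ℕ)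
    (a : Fin m) (b : Fin n) :
    Good m n (rankOf I J) U a b ↔ I.Edge a b ∧ ∀ c : Fin n, I.Edge a c → c ≠ b →
      (Either I J a c b → U b < U c) ∧ U b ≤ U c + 1 := by
  unfold Good
  rw [rankOf_fst_ne_zero]
  refine and_congr_right fun hb => ?_
  constructor
  · intro h c hc hne
    have := h c c.2 (rankOf_fst_ne_zero.2 hc) fun h' => hne (Fin.ext h')
    rw [either_iff_rankOf hE hb hc]
    split_ifs at this with hei
    · exact ⟨fun _ => this, by omega⟩
    · exact ⟨fun h' => absurd h' hei, this⟩
  · intro h c hc hrc hne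
    have hEc : I.Edge a ⟨c, hc⟩ := rankOf_fst_ne_zero.1 hrc
    have := h ⟨c, hc⟩ hEc fun h' => hne (by simpa using congrArg Fin.val h')
    rw [either_iff_rankOf hE hb hEc] at this
    split_ifs with hei
    · exact this.1 hei
    · exact this.2

/-- Rank n + 1 puts the outside option below every neighbour. With level 1, the strict inequality
then says that all neighbours have level at least 2, the certificate's condition for an unmatched
agent. -/
theorem good_out_iff {I J : Market m n} (U : ℕ → ℕ) (a : Fin m) (hU : U (n + a) = 1) :
    Good m n (rankOf I J) U a (n + a) ↔ ∀ c : Fin n, I.Edge a c → 2 ≤ U c := by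
  have hR := rankTable_rankOf I J
  unfold Good
  rw [hR.own a a.2, hU]
  constructor
  · intro h c hc
    have := h.2 c c.2 (rankOf_fst_ne_zero.2 hc) (by omega)
    rw [if_pos (Or.inl (by have := hR.le a a.2 c c.2; omega))] at this
    omega
  · intro h
    refine ⟨by omega, fun c hc hrc _ => ?_⟩
    rw [if_pos (Or.inl (by have := hR.le a a.2 c hc; omega))]
    exact h ⟨c, hc⟩ (rankOf_fst_ne_zero.1 hrc)

/-- The assignment of jobs that underlies an assignment of slots. -/
def jobAssign (m n : ℕ) (F : ℕ → ℕ) (a : Fin m) : Option (Fin n) :=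
  if h : F a < n then some ⟨F a, h⟩ else none

theorem jobAssign_eq_some {F : ℕ → ℕ} {a : Fin m} {b : Fin n} :
    jobAssign m n F a = some b ↔ F a = b := by
  unfold jobAssign
  split_ifs with h
  · simp [Fin.ext_iff]
  · constructor
    · simp
    · intro h'; omega

theorem Solution.certifies {I J : Market m n} (hE : ∀ a b, I.Edge a b ↔ J.Edge a b)
    {F U : ℕ → ℕ} (h : Solution m n (rankOf I J) F U) :
    Certifies I J (jobAssign m n F) fun b => U b where
  le_two b := h.lev.le_two b b.2
  inj a a' b hab hab' := by
    rw [jobAssign_eq_some] at hab hab'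
    exact Fin.ext (h.inj a a.2 a' a'.2 (hab.trans hab'.symm))
  edge a b hab := by
    rw [jobAssign_eq_some] at hab
    have := h.good a a.2
    rw [hab, good_job_iff hE] at this
    exact this.1
  up a b hab c hac hne he := by
    rw [jobAssign_eq_some] at hab
    have := h.good a a.2
    rw [hab, good_job_iff hE] at this
    exact (this.2 c hac hne).1 he
  down a b hab c hac hne := by
    rw [jobAssign_eq_some] at hab
    have := h.good a a.2
    rw [hab, good_job_iff hE] at this
    exact (this.2 c hac hne).2
  free a ha c hac := by
    have hF : ¬ F a < n := fun hlt => by simp [jobAssign, hlt] at ha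
    have hg := h.good a a.2
    rcases hg.slot_cases (rankTable_rankOf I J) a.2 (h.lt a a.2) with h1 | h1
    · exact absurd h1 hF
    · rw [h1, good_out_iff U a (h.lev.out a a.2)] at hg
      exact hg c hac
  cover b hb := by
    obtain ⟨a, ha, hab⟩ := h.cover b b.2 hb
    exact ⟨⟨a, ha⟩, jobAssign_eq_some.2 hab⟩

theorem Certifies.exists_solution {I J : Market m n} (hE : ∀ a b, I.Edge a b ↔ J.Edge a b)
    {f : Fin m → Option (Fin n)} {π : Fin n → ℕ} (h : Certifies I J f π) :
    ∃ F U, Solution m n (rankOf I J) F U := by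
  let U : ℕ → ℕ := fun s => if hs : s < n then π ⟨s, hs⟩ else 1
  let F : ℕ → ℕ := fun a => if ha : a < m then (f ⟨a, ha⟩).elim (n + a) Fin.val else 0
  have hU : ∀ b : Fin n, U b = π b := fun b => by simp [U]
  have hUo : ∀ a, U (n + a) = 1 := fun a => by simp [U]
  have hF : ∀ a : Fin m, F a = (f a).elim (n + a.val) Fin.val := fun a => by simp [F]
  have hlev : Levels m n U :=
    ⟨fun b hb => by rw [hU ⟨b, hb⟩]; exact h.le_two _, fun a _ => hUo a⟩
  refine ⟨F, U, hlev, ?_, ?_, ?_, ?_⟩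
  · intro a ha
    rw [hF ⟨a, ha⟩]
    cases f ⟨a, ha⟩ with
    | none => simp; omega
    | some b => simp; omega
  · intro a ha
    rw [hF ⟨a, ha⟩]
    cases hfa : f ⟨a, ha⟩ with
    | none =>
      refine (good_out_iff U ⟨a, ha⟩ (hUo a)).2 fun c hc => ?_
      rw [hU]; exact h.free _ hfa c hc
    | some b =>
      refine (good_job_iff hE U ⟨a, ha⟩ b).2 ⟨h.edge _ b hfa, fun c hc hne => ?_⟩
      rw [hU, hU]
      exact ⟨h.up _ b hfa c hc hne, h.down _ b hfa c hc hne⟩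
  · intro a ha a' ha' haa
    rw [hF ⟨a, ha⟩, hF ⟨a', ha'⟩] at haa
    cases hfa : f ⟨a, ha⟩ with
    | none =>
      cases hfa' : f ⟨a', ha'⟩ with
      | none => simpa [hfa, hfa'] using haa
      | some b => simp [hfa, hfa'] at haa; omega
    | some b =>
      cases hfa' : f ⟨a', ha'⟩ with
      | none => simp [hfa, hfa'] at haa; omega
      | some b' =>
        simp only [hfa, hfa', Option.elim] at haa
        have := Fin.ext haa
        subst this
        simpa using h.inj _ _ _ hfa hfa'
  · intro b hb hUb
    rw [hU ⟨b, hb⟩] at hUb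
    obtain ⟨a, ha⟩ := h.cover _ hUb
    exact ⟨a, a.2, by rw [hF a, ha]; rfl⟩

/-- Robust popular matchings are the solutions of the system of levels. -/
theorem exists_isRobustPopular_iff {I J : Market m n} (hIJ : I.DifferInOneAgent J) :
    (∃ M, I.IsRobustPopular J M) ↔ ∃ F U, Solution m n (rankOf I J) F U := by
  constructor
  · rintro ⟨M, hM⟩
    obtain ⟨f, rfl⟩ := exists_eq_edgesOf hM.1.1
    obtain ⟨π, hπ⟩ := exists_certifies hIJ hM
    exact hπ.exists_solution hIJ.1
  · rintro ⟨F, U, h⟩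
    exact ⟨_, (h.certifies hIJ.1).isRobustPopular hIJ.1⟩

end Bridge

/-! ### A timed program logic for the random access machine -/

section Logic

/-- The program `c` halts on `s` within `T` steps in a memory that satisfies `Q`. -/
def Runs (c : Prog) (s : Store) (T : ℕ) (Q : Store → Prop) : Prop :=
  ∃ s' t, Exec c s s' t ∧ t ≤ T ∧ Q s'

theorem Runs.mono {c : Prog} {s : Store} {T T' : ℕ} {Q Q' : Store → Prop} (h : Runs c s T Q)
    (hT : T ≤ T') (hQ : ∀ s', Q s' → Q' s') : Runs c s T' Q' := by
  obtain ⟨s', t, he, ht, hq⟩ := h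
  exact ⟨s', t, he, ht.trans hT, hQ _ hq⟩

theorem Runs.seq {c d : Prog} {s : Store} {T₁ T₂ : ℕ} {R Q : Store → Prop} (h : Runs c s T₁ R)
    (h' : ∀ s', R s' → Runs d s' T₂ Q) : Runs (.seq c d) s (T₁ + T₂) Q := by
  obtain ⟨s₁, t₁, he, ht, hr⟩ := h
  obtain ⟨s₂, t₂, he', ht', hq⟩ := h' s₁ hr
  exact ⟨s₂, _, .seq he he', Nat.add_le_add ht ht', hq⟩

theorem Runs.cond {e : Expr} {c d : Prog} {s : Store} {T : ℕ} {Q : Store → Prop}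
    (h : e.eval s ≠ 0 → Runs c s T Q) (h' : e.eval s = 0 → Runs d s T Q) :
    Runs (.cond e c d) s (e.cost + 1 + T) Q := by
  by_cases he : e.eval s = 0
  · obtain ⟨s', t, hx, ht, hq⟩ := h' he
    exact ⟨s', _, .cond_false he hx, by omega, hq⟩
  · obtain ⟨s', t, hx, ht, hq⟩ := h he
    exact ⟨s', _, .cond_true he hx, by omega, hq⟩

theorem Runs.loop {e : Expr} {c : Prog} {T : ℕ} (Inv : Store → Prop) (μ : Store → ℕ)
    (hstep : ∀ s, Inv s → e.eval s ≠ 0 → Runs c s T fun s' => Inv s' ∧ μ s' < μ s) (s : Store)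
    (h : Inv s) :
    Runs (.loop e c) s ((μ s + 1) * (T + e.cost + 1)) fun s' => Inv s' ∧ e.eval s' = 0 := by
  induction hk : μ s using Nat.strong_induction_on generalizing s with
  | _ k ih =>
    by_cases he : e.eval s = 0
    · refine ⟨s, _, .loop_false he, ?_, h, he⟩
      nlinarith [Nat.zero_le (k * (T + e.cost + 1))]
    · obtain ⟨s₁, t₁, hx, ht, hI, hμ⟩ := hstep s h he
      obtain ⟨s₂, t₂, hx', ht', hq⟩ := ih (μ s₁) (hk ▸ hμ) s₁ hI rfl
      refine ⟨s₂, _, .loop_true he hx hx', ?_, hq⟩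
      have : (μ s₁ + 1) * (T + e.cost + 1) ≤ k * (T + e.cost + 1) :=
        Nat.mul_le_mul_right _ (by omega)
      nlinarith

/-- The content of cell `0` of an array. -/
def var (r : ℕ) : Expr := .read r (.const 0)

/-- Assignment to cell `0` of an array. -/
def assign (r : ℕ) (e : Expr) : Prog := .write r (.const 0) e

/-- `for i < b do c`. -/
def forLoop (i : ℕ) (b : Expr) (c : Prog) : Prog :=
  .seq (assign i (.const 0))
    (.loop (.minus b (var i)) (.seq c (assign i (.plus (var i) (.const 1)))))

/-- The invariant describes the memory at the loop test, after the counter was advanced. Since it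
fixes the counter and the bound, exactly N passes are made. -/
theorem Runs.forLoop {i : ℕ} {b : Expr} {c : Prog} {s : Store} {T : ℕ} (N : ℕ)
    (Inv : ℕ → Store → Prop) (h0 : Inv 0 (s.set i 0 0))
    (hI : ∀ k s, k ≤ N → Inv k s → s i 0 = k ∧ b.eval s = N)
    (hstep : ∀ k s, k < N → Inv k s → Runs c s T fun s' => Inv (k + 1) (s'.set i 0 (s' i 0 + 1))) :
    Runs (forLoop i b c) s ((N + 1) * (T + b.cost + 14)) (Inv N) := by
  have key := Runs.loop (e := .minus b (var i))
    (c := .seq c (assign i (.plus (var i) (.const 1)))) (T := T + 6)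
    (fun s => ∃ k, k ≤ N ∧ Inv k s) (fun s => N - s i 0) (by
      rintro s ⟨k, hk, hinv⟩ he
      obtain ⟨h1, h2⟩ := hI k s hk hinv
      simp only [Expr.eval, var, h1, h2] at he
      refine Runs.seq (hstep k s (by omega) hinv) fun s' hs' => ?_
      refine ⟨_, _, .write _ _ _ _, by simp [var, Expr.cost], ⟨k + 1, by omega, hs'⟩, ?_⟩
      have h3 := (hI (k + 1) _ (by omega) hs').1
      change N - (s'.set i 0 (s' i 0 + 1)) i 0 < N - s i 0
      rw [h3, h1]; omega) (s.set i 0 0) ⟨0, Nat.zero_le _, h0⟩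
  have hz : N - (s.set i 0 0) i 0 = N := by simp [Store.set]
  rw [hz] at key
  refine (Runs.seq (T₁ := 3) (R := fun s' => s' = s.set i 0 0)
    ⟨_, _, .write _ _ _ _, by simp [Expr.cost], rfl⟩ fun s' hs' => hs' ▸ key).mono ?_ ?_
  · simp only [Expr.cost, var]
    nlinarith
  · rintro s' ⟨⟨k, hk, hinv⟩, he⟩
    obtain ⟨h1, h2⟩ := hI k s' hk hinv
    simp only [Expr.eval, var, h1, h2] at he
    obtain rfl : k = N := by omega
    exact hinv

/-- The weakest precondition of a program without loops. -/
def wp (Q : Store → Prop) : Prog → Store → Prop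
  | .skip, s => Q s
  | .write r i e, s => Q (s.set r (i.eval s) (e.eval s))
  | .seq c d, s => wp (wp Q d) c s
  | .cond e c d, s => (e.eval s ≠ 0 → wp Q c s) ∧ (e.eval s = 0 → wp Q d s)
  | .loop _ _, _ => False

/-- A bound for the running time of a program without loops. -/
def straightTime : Prog → ℕ
  | .skip => 1
  | .write _ i e => i.cost + e.cost + 1
  | .seq c d => straightTime c + straightTime d
  | .cond e c d => e.cost + 1 + (straightTime c + straightTime d)
  | .loop _ _ => 0

theorem Runs.straight {c : Prog} {s : Store} {Q : Store → Prop} (hQ : wp Q c s) :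
    Runs c s (straightTime c) Q := by
  induction c generalizing s Q with
  | skip => exact ⟨_, _, .skip s, le_rfl, hQ⟩
  | write r i e => exact ⟨_, _, .write r i e s, le_rfl, hQ⟩
  | seq c d ihc ihd => exact Runs.seq (ihc hQ) fun s' hs' => ihd hs'
  | cond e c d ihc ihd =>
    exact Runs.cond (fun he => (ihc (hQ.1 he)).mono (by omega) fun _ h => h)
      fun he => (ihd (hQ.2 he)).mono (by omega) fun _ h => h
  | loop e c => exact hQ.elim

theorem Store.set_apply (s : Store) (r i v r' i' : ℕ) :
    s.set r i v r' i' = if r' = r ∧ i' = i then v else s r' i' := by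
  unfold Store.set
  by_cases h : r' = r
  · subst h
    by_cases h' : i' = i <;> simp [h']
  · simp [h]

theorem Store.set_ne (s : Store) {r r' : ℕ} (i v : ℕ) (h : r' ≠ r) : s.set r i v r' = s r' := by
  simp [Store.set, h]

/-- The memories differ only in the listed arrays. -/
def Agree (l : List ℕ) (s s' : Store) : Prop := ∀ r, r ∉ l → s' r = s r

theorem Agree.refl (l : List ℕ) (s : Store) : Agree l s s := fun _ _ => rfl

theorem Agree.trans {l : List ℕ} {s s' s'' : Store} (h : Agree l s s') (h' : Agree l s' s'') :
    Agree l s s'' := fun r hr => (h' r hr).trans (h r hr)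

theorem Agree.mono {l l' : List ℕ} {s s' : Store} (h : Agree l s s') (hl : l ⊆ l') :
    Agree l' s s' := fun r hr => h r fun h' => hr (hl h')

theorem Agree.set {l : List ℕ} {s s' : Store} (h : Agree l s s') {r : ℕ} (i v : ℕ) (hr : r ∈ l) :
    Agree l s (s'.set r i v) := fun r' hr' => by
  rw [Store.set_ne _ _ _ (show r' ≠ r by rintro rfl; exact hr' hr)]
  exact h r' hr'

end Logic

/-! ### Testing the eligibility of an agent and a slot -/

section Search

variable {m n : ℕ} {rk : ℕ → ℕ → ℕ}

/-- The number of agents. -/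
def agents : Expr := .read 0 (.const 0)

/-- The number of jobs. -/
def jobs : Expr := .read 0 (.const 1)

/-- The number of slots. -/
def slots : Expr := .plus jobs agents

/-- The entry of the rank table in row `x` and column `e`. -/
def rankExpr (x e : Expr) : Expr := .read 2 (.plus (.read 3 x) e)

/-- The input parameters and the rank table are in place. -/
structure Tables (m n : ℕ) (rk : ℕ → ℕ → ℕ) (s : Store) : Prop where
  hm : s 0 0 = m
  hn : s 0 1 = n
  row : ∀ x < m + m, s 3 x = x * (n + m)
  rank : ∀ x < m + m, ∀ c < n + m, s 2 (x * (n + m) + c) = rk x c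

theorem Tables.agree {l : List ℕ} {s s' : Store} (h : Tables m n rk s) (ha : Agree l s s')
    (h0 : 0 ∉ l) (h2 : 2 ∉ l) (h3 : 3 ∉ l) : Tables m n rk s' := by
  constructor
  · rw [ha 0 h0]; exact h.hm
  · rw [ha 0 h0]; exact h.hn
  · rw [ha 3 h3]; exact h.row
  · rw [ha 2 h2]; exact h.rank

theorem Tables.eval_agents {s : Store} (h : Tables m n rk s) : agents.eval s = m := h.hm

theorem Tables.eval_jobs {s : Store} (h : Tables m n rk s) : jobs.eval s = n := h.hn

theorem Tables.eval_slots {s : Store} (h : Tables m n rk s) : slots.eval s = n + m := by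
  simp only [slots, Expr.eval, h.eval_agents, h.eval_jobs]

theorem Tables.eval_rank {s : Store} (h : Tables m n rk s) {x e : Expr} {i j : ℕ}
    (hx : x.eval s = i) (he : e.eval s = j) (hi : i < m + m) (hj : j < n + m) :
    (rankExpr x e).eval s = rk i j := by
  simp only [rankExpr, Expr.eval, hx, he, h.row i hi, h.rank i hi j hj]

theorem eval_var (s : Store) (r : ℕ) : (var r).eval s = s r 0 := rfl

/-- The condition that job `b` imposes on the use of slot `t` by agent `a`. -/
def Clause (m : ℕ) (rk : ℕ → ℕ → ℕ) (U : ℕ → ℕ) (a t b : ℕ) : Prop :=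
  rk a b ≠ 0 → b ≠ t →
    if rk a b < rk a t ∨ rk (m + a) b < rk (m + a) t then U t < U b else U t ≤ U b + 1

/-- Clears the flag in array `27` if the clause of the job in array `30` fails. -/
def clauseProg : Prog :=
  .cond (rankExpr (var 23) (var 30))
    (.cond (.plus (.minus (var 30) (var 24)) (.minus (var 24) (var 30)))
      (.cond (.plus
          (.minus (rankExpr (var 23) (var 24)) (rankExpr (var 23) (var 30)))
          (.minus (rankExpr (.plus agents (var 23)) (var 24))
            (rankExpr (.plus agents (var 23)) (var 30))))
        (.cond (.minus (.read 4 (var 30)) (.read 4 (var 24))) .skip (assign 27 (.const 0)))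
        (.cond (.minus (.plus (.read 4 (var 30)) (.const 2)) (.read 4 (var 24))) .skip
          (assign 27 (.const 0))))
      .skip)
    .skip

theorem wp_clauseProg {s : Store} (h : Tables m n rk s) {a t b : ℕ} (ha : s 23 0 = a)
    (ht : s 24 0 = t) (hb : s 30 0 = b) (ham : a < m) (htn : t < n + m) (hbn : b < n)
    {Q : Store → Prop} (h1 : Clause m rk (s 4) a t b → Q s)
    (h2 : ¬ Clause m rk (s 4) a t b → Q (s.set 27 0 0)) : wp Q clauseProg s := by
  have hva : (var 23).eval s = a := ha
  have hvt : (var 24).eval s = t := ht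
  have hvb : (var 30).eval s = b := hb
  have hvma : (Expr.plus agents (var 23)).eval s = m + a := by
    simp only [Expr.eval, h.eval_agents, hva]
  simp only [clauseProg, wp, assign, Expr.eval, hvt, hvb,
    h.eval_rank hva hvb (by omega) (by omega), h.eval_rank hva hvt (by omega) (by omega),
    h.eval_rank hvma hvb (by omega) (by omega), h.eval_rank hvma hvt (by omega) (by omega)]
  unfold Clause at h1 h2
  -- Comparisons are encoded by truncated subtraction: x − y is nonzero iff y < x, and a sum is
  -- nonzero iff one summand is. Adding 2 before subtracting tests U t ≤ U b + 1.
  refine ⟨fun h3 => ⟨fun h4 => ⟨fun h5 => ⟨fun h6 => h1 ?_, fun h6 => h2 ?_⟩, fun h5 =>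
    ⟨fun h6 => h1 ?_, fun h6 => h2 ?_⟩⟩, fun h4 => h1 ?_⟩, fun h3 => h1 ?_⟩
  · intro _ _; rw [if_pos (by omega)]; omega
  · intro h7; have := h7 h3 (by omega); rw [if_pos (by omega)] at this; omega
  · intro _ _; rw [if_neg (by omega)]; omega
  · intro h7; have := h7 h3 (by omega); rw [if_neg (by omega)] at this; omega
  · intro _ _; omega
  · intro h7; omega

/-- Sets the flag in array `27` if the agent in array `23` may buy the slot in array `24`. -/
def eligProg : Prog :=
  .seq (.seq (assign 27 (rankExpr (var 23) (var 24)))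
    (.cond (var 21) .skip
      (.cond (.minus jobs (var 24)) (.cond (.read 4 (var 24)) .skip (assign 27 (.const 0)))
        (assign 27 (.const 0)))))
    (forLoop 30 jobs clauseProg)

theorem runs_clauseProg_loop {s : Store} (h : Tables m n rk s) {a t : ℕ} (ha : s 23 0 = a)
    (ht : s 24 0 = t) (ham : a < m) (htn : t < n + m) :
    Runs (forLoop 30 jobs clauseProg) s ((n + 1) * 150) fun s' =>
      Agree [27, 30] s s' ∧ (s' 27 0 ≠ 0 ↔ s 27 0 ≠ 0 ∧ ∀ b < n, Clause m rk (s 4) a t b) := by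
  refine (Runs.forLoop (T := straightTime clauseProg) n (fun k s' => s' 30 0 = k ∧
    Agree [27, 30] s s' ∧ (s' 27 0 ≠ 0 ↔ s 27 0 ≠ 0 ∧ ∀ b < k, Clause m rk (s 4) a t b))
    ?_ ?_ ?_).mono ?_ ?_
  · refine ⟨by simp [Store.set_apply], (Agree.refl _ _).set _ _ (by simp), ?_⟩
    simp [Store.set_apply]
  · rintro k s' - ⟨h1, h2, -⟩
    exact ⟨h1, (h.agree h2 (by simp) (by simp) (by simp)).eval_jobs⟩
  · rintro k s' hk ⟨h1, h2, h3⟩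
    apply Runs.straight
    have hT := h.agree h2 (by simp) (by simp) (by simp)
    have h4 : s' 4 = s 4 := h2 4 (by simp)
    have hlt : ∀ P : ℕ → Prop, (∀ b < k + 1, P b) ↔ (∀ b < k, P b) ∧ P k := by
      intro P
      constructor
      · exact fun h => ⟨fun b hb => h b (by omega), h k (by omega)⟩
      · rintro ⟨h, h'⟩ b hb
        rcases Nat.lt_succ_iff_lt_or_eq.1 hb with hb | rfl
        · exact h b hb
        · exact h'
    rw [hlt]
    refine wp_clauseProg hT ((congrFun (h2 23 (by simp)) 0).trans ha)
      ((congrFun (h2 24 (by simp)) 0).trans ht) h1 ham htn hk (fun hc => ?_) fun hc => ?_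
    · rw [h4] at hc
      refine ⟨by simp [Store.set_apply, h1], h2.set _ _ (by simp), ?_⟩
      simp only [Store.set_apply]
      simp [h3, hc]
    · rw [h4] at hc
      refine ⟨by simp [Store.set_apply, h1], (h2.set _ _ (by simp)).set _ _ (by simp), ?_⟩
      simp [Store.set_apply, hc]
  · exact Nat.mul_le_mul_left _ (by decide)
  · exact fun s' h' => h'.2

theorem runs_eligProg {s : Store} (h : Tables m n rk s) {a t : ℕ} (ha : s 23 0 = a)
    (ht : s 24 0 = t) (ham : a < m) (htn : t < n + m) :
    Runs eligProg s (50 + (n + 1) * 150) fun s' =>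
      Agree [27, 30] s s' ∧ (s' 27 0 ≠ 0 ↔ Elig m n rk (s 4) (s 21 0) a t) := by
  -- The flag starts as the rank itself, which is zero exactly when there is no edge.
  refine Runs.seq (R := fun s' => Agree [27] s s' ∧
    (s' 27 0 ≠ 0 ↔ rk a t ≠ 0 ∧ (s 21 0 ≠ 0 ∨ t < n ∧ s 4 t ≠ 0))) ?_ ?_
  · refine (Runs.straight ?_).mono (by decide) fun _ h => h
    have hva : (var 23).eval s = a := ha
    have hvt : (var 24).eval s = t := ht
    have hr := h.eval_rank hva hvt (by omega) (by omega)
    have hj : s 0 1 = n := h.hn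
    have hag : Agree [27] s (s.set 27 0 (rk a t)) := (Agree.refl _ _).set _ _ (by simp)
    have h27 : s.set 27 0 (rk a t) 27 0 = rk a t := by simp [Store.set_apply]
    simp only [wp, assign, hr, Expr.eval]
    generalize s.set 27 0 (rk a t) = s₁ at hag h27 ⊢
    simp only [Expr.eval, var, jobs, hag 0 (by simp), hag 4 (by simp), hag 21 (by simp),
      hag 24 (by simp), ht, hj]
    have hz : (s₁.set 27 0 0) 27 0 = 0 := by simp [Store.set_apply]
    refine ⟨fun h1 => ⟨hag, by rw [h27]; omega⟩, fun h1 => ⟨fun h2 => ⟨fun h3 => ⟨hag, by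
      rw [h27]; omega⟩, fun h3 => ⟨hag.set _ _ (by simp), by rw [hz]; omega⟩⟩, fun h2 =>
      ⟨hag.set _ _ (by simp), by rw [hz]; omega⟩⟩⟩
  · rintro s₁ ⟨h1, h2⟩
    have hT := h.agree h1 (by simp) (by simp) (by simp)
    refine (runs_clauseProg_loop hT ((congrFun (h1 23 (by simp)) 0).trans ha)
      ((congrFun (h1 24 (by simp)) 0).trans ht) ham htn).mono le_rfl ?_
    rintro s₂ ⟨h3, h4⟩
    refine ⟨(h1.mono (by simp)).trans h3, ?_⟩
    rw [h4, h2, h1 4 (by simp)]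
    unfold Elig Good
    constructor
    · rintro ⟨⟨h5, h6⟩, h7⟩
      exact ⟨h6, h5, h7⟩
    · rintro ⟨h6, h5, h7⟩
      exact ⟨⟨h5, h6⟩, h7⟩

end Search

/-! ### Searching for a cheapest bid -/

section Bidding

variable {m n : ℕ} {rk : ℕ → ℕ → ℕ}

/-- The slots held by the agents. -/
def held (s : Store) (a : ℕ) : ℕ := s 1 (a + 1)

/-- Arrays `28` and `29` hold a cheapest bid among the pairs in `C`, and array `22` its price. -/
structure BestBid (m n : ℕ) (rk : ℕ → ℕ → ℕ) (s₀ : Store) (C : ℕ → ℕ → Prop) (s : Store) : Prop where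
  agree : Agree [22, 23, 24, 27, 28, 29, 30] s₀ s
  le : s 22 0 ≤ m + 2
  min : ∀ a < m, ∀ t < n + m, C a t → held s₀ a = 0 → Elig m n rk (s₀ 4) (s₀ 21 0) a t →
    s 22 0 ≤ s₀ 5 t
  attained : s 22 0 < m + 2 → s 28 0 < m ∧ s 29 0 < n + m ∧ held s₀ (s 28 0) = 0 ∧
    Elig m n rk (s₀ 4) (s₀ 21 0) (s 28 0) (s 29 0) ∧ s₀ 5 (s 29 0) = s 22 0

theorem BestBid.congr {s₀ s s' : Store} {C C' : ℕ → ℕ → Prop} (h : BestBid m n rk s₀ C s)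
    (hs : Agree [23, 24, 27, 30] s s') (hC : ∀ a < m, ∀ t < n + m, C' a t → C a t) :
    BestBid m n rk s₀ C' s' := by
  have h22 := hs 22 (by simp)
  have h28 := hs 28 (by simp)
  have h29 := hs 29 (by simp)
  refine ⟨h.agree.trans (hs.mono (by simp)), ?_, ?_, ?_⟩
  · rw [h22]; exact h.le
  · intro a ha t ht hc
    rw [h22]; exact h.min a ha t ht (hC a ha t ht hc)
  · rw [h22, h28, h29]; exact h.attained

/-- Compares the current agent and slot with the best bid so far. -/
def compareProg : Prog :=
  .cond (var 27)
    (.cond (.minus (var 22) (.read 5 (var 24)))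
      (.seq (assign 22 (.read 5 (var 24))) (.seq (assign 28 (var 23)) (assign 29 (var 24))))
      .skip)
    .skip

theorem wp_compareProg {s₀ s : Store} {C C' : ℕ → ℕ → Prop} {a t : ℕ} (h : BestBid m n rk s₀ C s)
    (ha : s 23 0 = a) (ht : s 24 0 = t) (ham : a < m) (htn : t < n + m) (hg : held s₀ a = 0)
    (hC : ∀ a' t', C' a' t' → C a' t' ∨ a' = a ∧ t' = t)
    (he : s 27 0 ≠ 0 ↔ Elig m n rk (s₀ 4) (s₀ 21 0) a t) {Q : Store → Prop}
    (hQ : ∀ s', Agree [22, 28, 29] s s' → BestBid m n rk s₀ C' s' → Q s') :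
    wp Q compareProg s := by
  have h5 : s 5 = s₀ 5 := h.agree 5 (by simp)
  simp only [compareProg, wp, assign, Expr.eval, var, Store.set_apply, ht, h5]
  simp only [Nat.reduceEqDiff, false_and, if_false, ha]
  refine ⟨fun h1 => ⟨fun h2 => hQ _ ?_ ⟨?_, ?_, ?_, ?_⟩, fun h2 => hQ _ (Agree.refl _ _)
    ⟨h.agree, h.le, ?_, h.attained⟩⟩, fun h1 => hQ _ (Agree.refl _ _)
    ⟨h.agree, h.le, ?_, h.attained⟩⟩
  · exact (((Agree.refl _ _).set _ _ (by simp)).set _ _ (by simp)).set _ _ (by simp)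
  · exact ((h.agree.set _ _ (by simp)).set _ _ (by simp)).set _ _ (by simp)
  · have := h.le
    simp [Store.set_apply]; omega
  · intro a' ha' t' ht' hc hg' he'
    simp only [Store.set_apply, Nat.reduceEqDiff, false_and, if_false, and_self, if_true]
    rcases hC a' t' hc with hc | ⟨rfl, rfl⟩
    · have := h.min a' ha' t' ht' hc hg' he'
      omega
    · rfl
  · intro _
    simp only [Store.set_apply, Nat.reduceEqDiff, false_and, if_false, and_self, if_true]
    exact ⟨ham, htn, hg, he.1 h1, trivial⟩
  · intro a' ha' t' ht' hc hg' he'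
    rcases hC a' t' hc with hc | ⟨rfl, rfl⟩
    · exact h.min a' ha' t' ht' hc hg' he'
    · omega
  · intro a' ha' t' ht' hc hg' he'
    rcases hC a' t' hc with hc | ⟨rfl, rfl⟩
    · exact h.min a' ha' t' ht' hc hg' he'
    · exact absurd h1 (he.2 he')

/-- Scans the slots for the agent in array `23`. -/
def scanSlots : Prog := forLoop 24 slots (.seq eligProg compareProg)

theorem runs_scanSlots {s₀ s : Store} (hT : Tables m n rk s₀) {a : ℕ}
    (h : BestBid m n rk s₀ (fun a' _ => a' < a) s) (ha : s 23 0 = a) (ham : a < m)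
    (hg : held s₀ a = 0) :
    Runs scanSlots s ((n + m + 1) * (200 + (n + 1) * 150)) fun s' =>
      BestBid m n rk s₀ (fun a' _ => a' < a + 1) s' ∧ s' 23 0 = a := by
  -- The pairs examined so far form an initial segment of the lexicographic order.
  refine (Runs.forLoop (T := 50 + (n + 1) * 150 + straightTime compareProg) (n + m) (fun k s' =>
    s' 24 0 = k ∧ BestBid m n rk s₀ (fun a' t' => a' < a ∨ a' = a ∧ t' < k) s' ∧ s' 23 0 = a)
    ?_ ?_ ?_).mono ?_ ?_
  · refine ⟨by simp [Store.set_apply], h.congr ((Agree.refl _ _).set _ _ (by simp)) ?_, ?_⟩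
    · intro a' _ t' _ hc; omega
    · simp [Store.set_apply, ha]
  · rintro k s' - ⟨h1, h2, -⟩
    exact ⟨h1, (hT.agree h2.agree (by simp) (by simp) (by simp)).eval_slots⟩
  · rintro k s' hk ⟨h1, h2, h3⟩
    have hT' := hT.agree h2.agree (by simp) (by simp) (by simp)
    refine Runs.seq (runs_eligProg hT' h3 h1 ham hk) ?_
    rintro s₁ ⟨hag, hel⟩
    rw [h2.agree 4 (by simp), h2.agree 21 (by simp)] at hel
    have h23 : s₁ 23 0 = a := by rw [hag 23 (by simp), h3]
    have h24 : s₁ 24 0 = k := by rw [hag 24 (by simp), h1]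
    apply Runs.straight
    refine wp_compareProg (C' := fun a' t' => a' < a ∨ a' = a ∧ t' < k + 1)
      (h2.congr (hag.mono (by simp)) fun _ _ _ _ hc => hc) h23 h24 ham hk hg ?_ hel ?_
    · intro a' t' hc; omega
    · intro s₂ hag₂ hb
      refine ⟨?_, hb.congr ((Agree.refl _ _).set _ _ (by simp)) fun _ _ _ _ hc => hc, ?_⟩
      · simp [Store.set_apply, hag₂ 24 (by simp), h24]
      · simp [Store.set_apply, hag₂ 23 (by simp), h23]
  · refine Nat.mul_le_mul_left _ ?_
    have : straightTime compareProg + slots.cost + 14 ≤ 150 := by decide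
    omega
  · rintro s' ⟨-, h2, h3⟩
    refine ⟨h2.congr (Agree.refl _ _) ?_, h3⟩
    intro a' _ t' _ hc; omega

/-- Searches for a cheapest bid of a free agent. -/
def searchProg : Prog :=
  .seq (assign 22 (.plus agents (.const 2)))
    (forLoop 23 agents (.cond (.read 1 (.plus (var 23) (.const 1))) .skip scanSlots))

theorem runs_searchProg {s : Store} (hT : Tables m n rk s) :
    Runs searchProg s (10 + (m + 1) * (50 + (n + m + 1) * (200 + (n + 1) * 150))) fun s' =>
      BestBid m n rk s (fun _ _ => True) s' := by
  -- The price m + 2 is a sentinel for no bid, as slots at that price may not be bought.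
  refine Runs.seq (R := fun s' => s' = s.set 22 0 (m + 2)) ?_ ?_
  · refine (Runs.straight ?_).mono (by decide) fun _ h => h
    simp only [wp, assign, Expr.eval, hT.eval_agents]
  rintro _ rfl
  refine (Runs.forLoop (T := 6 + (n + m + 1) * (200 + (n + 1) * 150)) m (fun k s' => s' 23 0 = k ∧
    BestBid m n rk s (fun a' _ => a' < k) s') ?_ ?_ ?_).mono ?_ ?_
  · refine ⟨by simp [Store.set_apply], ?_, ?_, ?_, ?_⟩
    · exact ((Agree.refl _ _).set _ _ (by simp)).set _ _ (by simp)
    · simp [Store.set_apply]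
    · intro a' _ t' _ hc; omega
    · simp [Store.set_apply]
  · rintro k s' - ⟨h1, h2⟩
    exact ⟨h1, (hT.agree h2.agree (by simp) (by simp) (by simp)).eval_agents⟩
  · rintro k s' hk ⟨h1, h2⟩
    have hrd : (Expr.read 1 (.plus (var 23) (.const 1))).eval s' = held s k := by
      simp only [Expr.eval, var, h1, held, h2.agree 1 (by simp)]
    refine (Runs.cond (T := (n + m + 1) * (200 + (n + 1) * 150)) (fun h3 => ?_)
      fun h3 => ?_).mono (by simp [Expr.cost, var]) fun _ h => h
    · rw [hrd] at h3
      refine ⟨_, _, .skip _, ?_, ?_, ?_⟩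
      · nlinarith
      · simp [Store.set_apply, h1]
      · refine ⟨h2.agree.set _ _ (by simp), ?_, ?_, ?_⟩
        · simpa [Store.set_apply] using h2.le
        · intro a' ha' t' ht' hc hg' he'
          have hne : a' ≠ k := by rintro rfl; exact h3 hg'
          simpa [Store.set_apply] using h2.min a' ha' t' ht' (by omega) hg' he'
        · simpa [Store.set_apply] using h2.attained
    · rw [hrd] at h3
      refine (runs_scanSlots hT h2 h1 hk h3).mono le_rfl ?_
      rintro s'' ⟨h4, h5⟩
      refine ⟨by simp [Store.set_apply, h5], ?_⟩
      exact h4.congr ((Agree.refl _ _).set _ _ (by simp)) fun _ _ _ _ hc => hc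
  · refine Nat.mul_le_mul_left _ ?_
    have : agents.cost = 2 := rfl
    omega
  · rintro s' ⟨-, h2⟩
    exact h2.congr (Agree.refl _ _) fun a' ha' _ _ _ => ha'

end Bidding

/-! ### The main loop and its progress measure -/

section Round

variable {m n : ℕ} {rk : ℕ → ℕ → ℕ}

/-- The agent in array `28` buys the slot in array `29`. -/
def bidProg : Prog :=
  .seq (.cond (.read 6 (var 29)) (.write 1 (.read 6 (var 29)) (.const 0)) .skip)
    (.seq (.write 1 (.plus (var 28) (.const 1)) (.plus (var 29) (.const 1)))
      (.seq (.write 6 (var 29) (.plus (var 28) (.const 1)))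
        (.write 5 (var 29) (.plus (.read 5 (var 29)) (.const 1)))))

theorem wp_bidProg {s : Store} {a t : ℕ} (ha : s 28 0 = a) (ht : s 29 0 = t)
    {Q : Store → Prop} (hQ : ∀ s', Agree [1, 5, 6] s s' → s' 1 0 = s 1 0 →
      held s' = (fun x => if x = a then t + 1 else if s 6 t = x + 1 then 0 else held s x) →
      s' 6 = Function.update (s 6) t (a + 1) → s' 5 = Function.update (s 5) t (s 5 t + 1) → Q s') :
    wp Q bidProg s := by
  simp only [bidProg, wp, Expr.eval, var, Store.set_apply, ha, ht, Nat.reduceEqDiff, false_and,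
    if_false]
  -- The owner code, agent plus one, is also the address of that agent's cell in array `1`. The code
  -- 0 of an unheld slot is skipped because cell 0 is reserved for the verdict.
  refine ⟨fun h => hQ _ ?_ ?_ ?_ ?_ ?_, fun h => hQ _ ?_ ?_ ?_ ?_ ?_⟩
  · exact ((((Agree.refl _ _).set _ _ (by simp)).set _ _ (by simp)).set _ _ (by simp)).set _ _
      (by simp)
  · simp [Store.set_apply]; omega
  · funext x
    simp only [held, Store.set_apply, Nat.reduceEqDiff, false_and, if_false, true_and,
      Nat.add_right_cancel_iff, eq_comm (a := x + 1)]
    simp only [eq_comm]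
  · funext i
    simp [Store.set_apply, Function.update_apply]
  · funext i
    simp [Store.set_apply, Function.update_apply]
  · exact (((Agree.refl _ _).set _ _ (by simp)).set _ _ (by simp)).set _ _ (by simp)
  · simp [Store.set_apply]
  · funext x
    simp only [held, Store.set_apply, Nat.reduceEqDiff, false_and, if_false, true_and,
      Nat.add_right_cancel_iff, h]
  · funext i
    simp [Store.set_apply, Function.update_apply]
  · funext i
    simp [Store.set_apply, Function.update_apply]

/-- Lowers the levels of the jobs which are not held, and records in array `25` if there is a change. -/
def lowerProg : Prog :=
  .seq (assign 25 (.const 0))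
    (forLoop 26 jobs (.cond (.read 6 (var 26)) .skip (.cond (.read 4 (var 26))
      (.seq (.write 4 (var 26) (.minus (.read 4 (var 26)) (.const 1))) (assign 25 (.const 1)))
      .skip)))

theorem runs_lowerProg {s : Store} (hT : Tables m n rk s) :
    Runs lowerProg s (10 + (n + 1) * 100) fun s' => Agree [4, 25, 26] s s' ∧
      (s' 4 = fun b => if b < n ∧ s 6 b = 0 then s 4 b - 1 else s 4 b) ∧
      (s' 25 0 ≠ 0 ↔ ∃ b < n, s 6 b = 0 ∧ s 4 b ≠ 0) := by
  refine Runs.seq (T₁ := 10) (R := fun s' => s' = s.set 25 0 0)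
    ((Runs.straight (by simp [wp, assign, Expr.eval])).mono (by decide) fun _ h => h) ?_
  rintro _ rfl
  refine (Runs.forLoop (T := 60) n (fun k s' => s' 26 0 = k ∧ Agree [4, 25, 26] s s' ∧
      (s' 4 = fun b => if b < k ∧ s 6 b = 0 then s 4 b - 1 else s 4 b) ∧
      (s' 25 0 ≠ 0 ↔ ∃ b < k, s 6 b = 0 ∧ s 4 b ≠ 0)) ?_ ?_ ?_).mono ?_ ?_
  · refine ⟨by simp [Store.set_apply], ?_, ?_, ?_⟩
    · exact ((Agree.refl _ _).set _ _ (by simp)).set _ _ (by simp)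
    · funext b; simp [Store.set_apply]
    · simp [Store.set_apply]
  · rintro k s' - ⟨h1, h2, -⟩
    exact ⟨h1, (hT.agree h2 (by simp) (by simp) (by simp)).eval_jobs⟩
  · rintro k s' hk ⟨h1, h2, h3, h4⟩
    refine (Runs.straight ?_).mono (by decide) fun _ h => h
    have h6 : s' 6 = s 6 := h2 6 (by simp)
    have h4k : s' 4 k = s 4 k := by rw [h3]; simp
    simp only [wp, Expr.eval, var, assign, h1, h6, h4k]
    refine ⟨fun h5 => ⟨by simp [Store.set_apply], h2.set _ _ (by simp), ?_, ?_⟩, fun h5 =>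
      ⟨fun h7 => ⟨by simp [Store.set_apply, h1], ((h2.set _ _ (by simp)).set _ _ (by simp)).set _ _
        (by simp), ?_, ?_⟩, fun h7 => ⟨by simp [Store.set_apply], h2.set _ _ (by simp), ?_, ?_⟩⟩⟩
    · funext b
      simp only [Store.set_apply, Nat.reduceEqDiff, false_and, if_false, h3]
      have : b = k → s 6 b ≠ 0 := by rintro rfl; exact h5
      split_ifs <;> first | rfl | omega
    · simp only [Store.set_apply, Nat.reduceEqDiff, false_and, if_false, h4]
      constructor
      · rintro ⟨b, hb, h⟩; exact ⟨b, by omega, h⟩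
      · rintro ⟨b, hb, h⟩
        refine ⟨b, ?_, h⟩
        have : b ≠ k := by rintro rfl; exact h5 h.1
        omega
    · funext b
      simp only [Store.set_apply, Nat.reduceEqDiff, false_and, if_false, h3, true_and]
      by_cases hb : b = k
      · subst hb; simp [h5]
      · have : b < k + 1 ↔ b < k := by omega
        simp [hb, this]
    · simp only [Store.set_apply]
      simp only [Nat.reduceEqDiff, false_and, if_false, and_self, if_true]
      exact ⟨fun _ => ⟨k, by omega, h5, h7⟩, fun _ => one_ne_zero⟩
    · funext b
      simp only [Store.set_apply, Nat.reduceEqDiff, false_and, if_false, h3]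
      by_cases hb : b = k
      · subst hb; simp [h7]
      · have : b < k + 1 ↔ b < k := by omega
        simp [this]
    · simp only [Store.set_apply, Nat.reduceEqDiff, false_and, if_false, h4]
      constructor
      · rintro ⟨b, hb, h⟩; exact ⟨b, by omega, h⟩
      · rintro ⟨b, hb, h⟩
        refine ⟨b, ?_, h⟩
        have : b ≠ k := by rintro rfl; exact h.2 h7
        omega
  · exact Nat.mul_le_mul_left _ (by decide)
  · exact fun s' h => h.2

/-- Sets all prices to zero. -/
def clearPrices : Prog := forLoop 26 slots (.write 5 (var 26) (.const 0))

theorem runs_clearPrices {s : Store} (hT : Tables m n rk s) :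
    Runs clearPrices s ((n + m + 1) * 100) fun s' => Agree [5, 26] s s' ∧
      ∀ t < n + m, s' 5 t = 0 := by
  refine (Runs.forLoop (T := 20) (n + m) (fun k s' => s' 26 0 = k ∧ Agree [5, 26] s s' ∧
      ∀ t < k, s' 5 t = 0) ?_ ?_ ?_).mono ?_ ?_
  · exact ⟨by simp [Store.set_apply], (Agree.refl _ _).set _ _ (by simp), by simp⟩
  · rintro k s' - ⟨h1, h2, -⟩
    exact ⟨h1, (hT.agree h2 (by simp) (by simp) (by simp)).eval_slots⟩
  · rintro k s' hk ⟨h1, h2, h3⟩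
    refine (Runs.straight ?_).mono (by decide) fun _ h => h
    simp only [wp, Expr.eval, var, h1]
    refine ⟨by simp [Store.set_apply, h1], (h2.set _ _ (by simp)).set _ _ (by simp), ?_⟩
    intro t ht
    simp only [Store.set_apply, Nat.reduceEqDiff, false_and, if_false, true_and]
    split_ifs with h
    · rfl
    · exact h3 t (by omega)
  · exact Nat.mul_le_mul_left _ (by decide)
  · exact fun s' h => h.2

/-- Discards the current assignment and all prices. -/
def resetProg : Prog :=
  forLoop 26 slots (.seq (.write 1 (.plus (var 26) (.const 1)) (.const 0))
    (.seq (.write 5 (var 26) (.const 0)) (.write 6 (var 26) (.const 0))))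

theorem runs_resetProg {s : Store} (hT : Tables m n rk s) :
    Runs resetProg s ((n + m + 1) * 100) fun s' => Agree [1, 5, 6, 26] s s' ∧ s' 1 0 = s 1 0 ∧
      ∀ t < n + m, held s' t = 0 ∧ s' 5 t = 0 ∧ s' 6 t = 0 := by
  refine (Runs.forLoop (T := 50) (n + m) (fun k s' => s' 26 0 = k ∧ Agree [1, 5, 6, 26] s s' ∧
      s' 1 0 = s 1 0 ∧ ∀ t < k, held s' t = 0 ∧ s' 5 t = 0 ∧ s' 6 t = 0) ?_ ?_ ?_).mono ?_ ?_
  · exact ⟨by simp [Store.set_apply], (Agree.refl _ _).set _ _ (by simp),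
      by simp [Store.set_apply], by simp⟩
  · rintro k s' - ⟨h1, h2, -⟩
    exact ⟨h1, (hT.agree h2 (by simp) (by simp) (by simp)).eval_slots⟩
  · rintro k s' hk ⟨h1, h2, h3, h4⟩
    refine (Runs.straight ?_).mono (by decide) fun _ h => h
    simp only [wp, Expr.eval, var, h1, Store.set_apply, Nat.reduceEqDiff, false_and, if_false]
    refine ⟨by simp,
      (((h2.set _ _ (by simp)).set _ _ (by simp)).set _ _ (by simp)).set _ _ (by simp), ?_, ?_⟩
    · simp [h3]
    · intro t ht
      simp only [held, Store.set_apply, Nat.reduceEqDiff, false_and, if_false, true_and,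
        Nat.add_right_cancel_iff]
      split_ifs with h
      · exact ⟨rfl, rfl, rfl⟩
      · exact h4 t (by omega)
  · exact Nat.mul_le_mul_left _ (by decide)
  · exact fun s' h => h.2

/-- One round of the algorithm. -/
def roundProg : Prog :=
  .seq searchProg (.cond (.minus (.plus agents (.const 2)) (var 22)) bidProg
    (.seq lowerProg (.cond (var 25) resetProg
      (.cond (var 21) (assign 20 (.const 0)) (.seq (assign 21 (.const 1)) clearPrices)))))

/-- The invariant of the main loop. -/
structure MainInv (m n : ℕ) (rk : ℕ → ℕ → ℕ) (s : Store) : Prop where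
  tables : Tables m n rk s
  upper : UpperLevels m n rk (s 4)
  auction : AuctionState m n rk (s 4) (s 21 0) (held s) (s 6) (s 5)
  phase : s 21 0 ≤ 1
  verdict : s 1 0 = 0
  halted : s 20 0 = 0 → s 21 0 ≠ 0 ∧ NoBid m n rk (s 4) (s 21 0) (held s) (s 5)

/-- A bound for the sum of the prices. -/
def priceBound (m n : ℕ) : ℕ := (n + m) * (m + 2)

/-- The measure that decreases in every round. -/
def progress (m n : ℕ) (s : Store) : ℕ :=
  s 20 0 + (∑ b ∈ Finset.range n, s 4 b) * (2 * (priceBound m n + 1)) +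
    (1 - s 21 0) * (priceBound m n + 1) +
    (priceBound m n - ∑ t ∈ Finset.range (n + m), s 5 t)

theorem AuctionState.sum_price_le {U g o p : ℕ → ℕ} {ph : ℕ}
    (h : AuctionState m n rk U ph g o p) :
    ∑ t ∈ Finset.range (n + m), p t ≤ priceBound m n := by
  calc _ ≤ ∑ t ∈ Finset.range (n + m), (m + 2) :=
        Finset.sum_le_sum fun t ht => h.p_le t (Finset.mem_range.1 ht)
    _ = priceBound m n := by simp [priceBound]

/-- A bound for the running time of one round. -/
def roundTime (m n : ℕ) : ℕ :=
  10 + (m + 1) * (50 + (n + m + 1) * (200 + (n + 1) * 150)) + (100 + (n + 1) * 100 +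
    (n + m + 1) * 100)

/-- Only one price changes, and it rises by one. As the price sum stays within its bound, the
truncated difference in the measure decreases. -/
theorem runs_bid {s₀ s : Store} (h : MainInv m n rk s₀) (hrun : s₀ 20 0 ≠ 0)
    (hb : BestBid m n rk s₀ (fun _ _ => True) s) (hlt : s 22 0 < m + 2) :
    Runs bidProg s 100 fun s' => MainInv m n rk s' ∧ progress m n s' < progress m n s₀ := by
  obtain ⟨h28, h29, hfree, hel, hp⟩ := hb.attained hlt
  refine (Runs.straight (wp_bidProg rfl rfl ?_)).mono (by decide) fun _ h => h
  intro s' hag h10 hheld h6 h5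
  have hag' : Agree [1, 5, 6, 22, 23, 24, 27, 28, 29, 30] s₀ s' :=
    (hb.agree.mono (by simp)).trans (hag.mono (by simp))
  have hh : held s = held s₀ := by
    funext x; simp only [held]; rw [hb.agree 1 (by simp)]
  rw [hb.agree 6 (by simp), hh] at hheld
  rw [hb.agree 6 (by simp)] at h6
  rw [hb.agree 5 (by simp)] at h5
  rw [hb.agree 1 (by simp)] at h10
  have hauc := h.auction.bid h28 h29 hfree hel (by omega) (fun t ht het => by
    rw [hp]; exact hb.min _ h28 t ht trivial hfree het)
  rw [← hheld, ← h6, ← h5] at hauc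
  have e4 : s' 4 = s₀ 4 := hag' 4 (by simp)
  have e21 : s' 21 = s₀ 21 := hag' 21 (by simp)
  have e20 : s' 20 = s₀ 20 := hag' 20 (by simp)
  rw [← e4, ← e21] at hauc
  refine ⟨⟨h.tables.agree hag' (by simp) (by simp) (by simp), by rw [e4]; exact h.upper, hauc,
    by rw [e21]; exact h.phase, by rw [h10]; exact h.verdict, fun h0 => ?_⟩, ?_⟩
  · rw [e20] at h0; exact absurd h0 hrun
  · have hle := hauc.sum_price_le
    unfold progress
    rw [e4, e21, e20]
    have hsum : ∑ t ∈ Finset.range (n + m), s' 5 t =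
        ∑ t ∈ Finset.range (n + m), s₀ 5 t + 1 := by
      rw [h5, Finset.sum_update_of_mem (Finset.mem_range.2 h29),
        Finset.sdiff_singleton_eq_erase, ← Finset.add_sum_erase _ (s₀ 5) (Finset.mem_range.2 h29)]
      ring
    omega

/-- There are three outcomes: some level drops and the auction restarts, the second phase begins, or
the loop stops. The weights in `progress` let each drop pay for clearing all prices. -/
theorem runs_noBid {s₀ s : Store} (hR : RankTable m n rk) (h : MainInv m n rk s₀)
    (hrun : s₀ 20 0 ≠ 0) (hb : BestBid m n rk s₀ (fun _ _ => True) s) (hge : ¬ s 22 0 < m + 2) :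
    Runs (.seq lowerProg (.cond (var 25) resetProg
      (.cond (var 21) (assign 20 (.const 0)) (.seq (assign 21 (.const 1)) clearPrices)))) s
      (50 + (n + 1) * 100 + (n + m + 1) * 100) fun s' =>
        MainInv m n rk s' ∧ progress m n s' < progress m n s₀ := by
  have hno : NoBid m n rk (s₀ 4) (s₀ 21 0) (held s₀) (s₀ 5) := fun a ha hfree t ht he => by
    have := hb.min a ha t ht trivial hfree he
    omega
  have hT := h.tables.agree hb.agree (by simp) (by simp) (by simp)
  have hle := h.auction.sum_price_le
  refine (Runs.seq (runs_lowerProg hT) (T₂ := 40 + (n + m + 1) * 100) ?_).mono (by omega)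
    fun _ h => h
  rintro s₁ ⟨hag, h4, h25⟩
  rw [hb.agree 4 (by simp), hb.agree 6 (by simp)] at h4 h25
  have hag₁ : Agree [4, 22, 23, 24, 25, 26, 27, 28, 29, 30] s₀ s₁ :=
    (hb.agree.mono (by simp)).trans (hag.mono (by simp))
  have hT₁ := h.tables.agree hag₁ (by simp) (by simp) (by simp)
  have hup := h.upper.lower h.auction hR hno
  rw [← h4] at hup
  refine (Runs.cond (T := 20 + (n + m + 1) * 100) (fun hc => ?_) fun hc => ?_).mono
    (by simp [var, Expr.cost]; omega) fun _ h => h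
  · obtain ⟨b, hbn, hob, hUb⟩ := h25.1 hc
    -- In the second phase every job of positive level is covered, so levels can drop only in the
    -- first.
    have hph : s₀ 21 0 = 0 := by
      by_contra hph
      exact h.auction.cover hph b hbn hUb hob
    refine (runs_resetProg hT₁).mono (by omega) ?_
    rintro s₂ ⟨hag₂, h10, hz⟩
    have hag₃ : Agree [1, 4, 5, 6, 22, 23, 24, 25, 26, 27, 28, 29, 30] s₀ s₂ :=
      (hag₁.mono (by simp)).trans (hag₂.mono (by simp))
    have e21 : s₂ 21 0 = 0 := by rw [hag₃ 21 (by simp)]; exact hph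
    have e20 : s₂ 20 = s₀ 20 := hag₃ 20 (by simp)
    have e4 : s₂ 4 = s₁ 4 := hag₂ 4 (by simp)
    refine ⟨⟨h.tables.agree hag₃ (by simp) (by simp) (by simp), by rw [e4]; exact hup, ?_, by omega,
      by rw [h10, hag₁ 1 (by simp)]; exact h.verdict, fun h0 => ?_⟩, ?_⟩
    · rw [e21]
      exact AuctionState.reset _ (fun a ha => (hz a (by omega)).1) (fun t ht => (hz t ht).2.2)
        fun t ht => (hz t ht).2.1
    · rw [e20] at h0; exact absurd h0 hrun
    · have hlt : ∑ b ∈ Finset.range n, s₂ 4 b < ∑ b ∈ Finset.range n, s₀ 4 b := by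
        rw [e4, h4]
        refine Finset.sum_lt_sum (fun i _ => ?_) ⟨b, Finset.mem_range.2 hbn, ?_⟩
        · split_ifs <;> omega
        · rw [if_pos ⟨hbn, hob⟩]; omega
      unfold progress
      rw [e20, e21, hph]
      generalize ∑ b ∈ Finset.range n, s₂ 4 b = x at hlt ⊢
      generalize ∑ b ∈ Finset.range n, s₀ 4 b = y at hlt ⊢
      have := Nat.mul_le_mul_right (2 * (priceBound m n + 1)) (Nat.succ_le_of_lt hlt)
      rw [Nat.succ_mul] at this
      omega
  · have hcov : ∀ b < n, s₀ 4 b ≠ 0 → s₀ 6 b ≠ 0 := by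
      intro b hbn hUb hob
      exact h25.2 ⟨b, hbn, hob, hUb⟩ hc
    have e4 : s₁ 4 = s₀ 4 := by
      rw [h4]; funext b
      split_ifs with hbb
      · have : s₀ 4 b = 0 := by
          by_contra hUb
          exact hcov b hbb.1 hUb hbb.2
        omega
      · rfl
    have hh : ∀ s', s' 1 = s₀ 1 → held s' = held s₀ := fun s' h => by
      funext x; simp only [held, h]
    refine (Runs.cond (T := 10 + (n + m + 1) * 100) (fun hc => ?_) fun hc => ?_).mono
      (by simp [var, Expr.cost]; omega) fun _ h => h
    · have hph : s₀ 21 0 ≠ 0 := by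
        rw [eval_var, hag₁ 21 (by simp)] at hc; exact hc
      refine Runs.mono (T := straightTime (assign 20 (.const 0)))
        (Q := fun s' => s' = s₁.set 20 0 0) (Runs.straight rfl) ?_ ?_
      · have : straightTime (assign 20 (.const 0)) = 3 := rfl
        omega
      · rintro _ rfl
        have hag₂ : Agree [4, 20, 22, 23, 24, 25, 26, 27, 28, 29, 30] s₀ (s₁.set 20 0 0) :=
          (hag₁.mono (by simp)).set _ _ (by simp)
        have e4' : (s₁.set 20 0 0) 4 = s₀ 4 := by rw [Store.set_ne _ _ _ (by simp), e4]
        have e20 : (s₁.set 20 0 0) 20 0 = 0 := by simp [Store.set_apply]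
        generalize s₁.set 20 0 0 = s₂ at hag₂ e4' e20
        have e21 := hag₂ 21 (by simp)
        have e1 := hag₂ 1 (by simp)
        have e5 := hag₂ 5 (by simp)
        have e6 := hag₂ 6 (by simp)
        refine ⟨⟨h.tables.agree hag₂ (by simp) (by simp) (by simp), by rw [e4']; exact h.upper, ?_,
          by rw [e21]; exact h.phase, by rw [e1]; exact h.verdict, fun _ => ?_⟩, ?_⟩
        · rw [e4', e21, e5, e6, hh _ e1]; exact h.auction
        · rw [e4', e21, e5, hh _ e1]; exact ⟨hph, hno⟩
        · unfold progress
          rw [e4', e21, e5, e20]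
          omega
    · have hph : s₀ 21 0 = 0 := by
        rw [eval_var, hag₁ 21 (by simp)] at hc; exact hc
      refine (Runs.seq (R := fun s' => s' = s₁.set 21 0 1)
        (Runs.straight (c := assign 21 (.const 1)) rfl)
        (T₂ := (n + m + 1) * 100) (Q := fun s' =>
          MainInv m n rk s' ∧ progress m n s' < progress m n s₀) ?_).mono ?_ fun _ h => h
      · rintro _ rfl
        refine (runs_clearPrices (hT₁.agree ((Agree.refl [21] _).set _ _ (by simp)) (by simp)
          (by simp) (by simp))).mono le_rfl ?_
        rintro s₂ ⟨hag₂, hz⟩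
        have hag₃ : Agree [4, 5, 21, 22, 23, 24, 25, 26, 27, 28, 29, 30] s₀ s₂ :=
          ((hag₁.mono (by simp)).set _ _ (by simp)).trans (hag₂.mono (by simp))
        have e4' : s₂ 4 = s₀ 4 := by
          rw [hag₂ 4 (by simp), Store.set_ne _ _ _ (by simp), e4]
        have e21 : s₂ 21 0 = 1 := by
          rw [hag₂ 21 (by simp)]; simp [Store.set_apply]
        have e1 := hag₃ 1 (by simp)
        have e6 := hag₃ 6 (by simp)
        have e20 := hag₃ 20 (by simp)
        refine ⟨⟨h.tables.agree hag₃ (by simp) (by simp) (by simp), by rw [e4']; exact h.upper, ?_,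
          by omega, by rw [e1]; exact h.verdict, fun h0 => ?_⟩, ?_⟩
        · rw [e4', e21, e6, hh _ e1]; exact h.auction.next_phase hcov hz
        · rw [e20] at h0; exact absurd h0 hrun
        · unfold progress
          rw [e4', e21, e20, hph]
          omega
      · have : straightTime (assign 21 (.const 1)) = 3 := rfl
        omega

theorem runs_roundProg {s : Store} (hR : RankTable m n rk) (h : MainInv m n rk s)
    (hrun : s 20 0 ≠ 0) : Runs roundProg s (roundTime m n) fun s' =>
      MainInv m n rk s' ∧ progress m n s' < progress m n s := by
  refine (Runs.seq (runs_searchProg h.tables) (T₂ := 100 + (n + 1) * 100 +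
    (n + m + 1) * 100) ?_).mono le_rfl fun _ h => h
  intro s₁ hb
  have hev : (Expr.minus (.plus agents (.const 2)) (var 22)).eval s₁ = m + 2 - s₁ 22 0 := by
    simp only [Expr.eval, var,
      (h.tables.agree hb.agree (by simp) (by simp) (by simp)).eval_agents]
  refine (Runs.cond (T := 50 + (n + 1) * 100 + (n + m + 1) * 100) (fun hc => ?_) fun hc => ?_).mono
    (by simp [Expr.cost, agents, var]; omega) fun _ h => h
  · rw [hev] at hc
    exact (runs_bid h hrun hb (by omega)).mono (by omega) fun _ h => h
  · rw [hev] at hc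
    exact runs_noBid hR h hrun hb (by omega)

/-- The main loop. -/
def mainLoop : Prog := .loop (var 20) roundProg

/-- A bound for the initial progress measure. -/
def roundBound (m n : ℕ) : ℕ := 3 * (priceBound m n + 1) + 2 * n * (2 * (priceBound m n + 1))

theorem runs_mainLoop {s : Store} (hR : RankTable m n rk) (h : MainInv m n rk s)
    (hrun : s 20 0 = 1) : Runs mainLoop s ((roundBound m n + 1) * (roundTime m n + 3)) fun s' =>
      MainInv m n rk s' ∧ s' 20 0 = 0 := by
  refine (Runs.loop (e := var 20) (MainInv m n rk) (progress m n)
    (fun s hs he => runs_roundProg hR hs he) s h).mono ?_ fun s' h => h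
  -- With B the price bound, flag, phase and prices contribute at most 1, B + 1 and B, and the
  -- levels sum to at most 2n.
  refine Nat.mul_le_mul (Nat.succ_le_succ ?_) le_rfl
  have hsum : ∑ b ∈ Finset.range n, s 4 b ≤ 2 * n := by
    calc _ ≤ ∑ b ∈ Finset.range n, 2 :=
          Finset.sum_le_sum fun b hb => h.upper.lev.le_two b (Finset.mem_range.1 hb)
      _ = 2 * n := by simp [mul_comm]
  unfold progress roundBound
  have h1 := Nat.mul_le_mul_right (2 * (priceBound m n + 1)) hsum
  have h2 : (1 - s 21 0) * (priceBound m n + 1) ≤ priceBound m n + 1 := by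
    calc _ ≤ 1 * (priceBound m n + 1) := Nat.mul_le_mul_right _ (by omega)
      _ = _ := one_mul _
  omega

/-- Writes the verdict. -/
def verdictProg : Prog :=
  .seq (.write 1 (.const 0) (.const 1))
    (forLoop 26 agents (.cond (.read 1 (.plus (var 26) (.const 1))) .skip
      (.write 1 (.const 0) (.const 0))))

theorem runs_verdictProg {s : Store} (hT : Tables m n rk s) :
    Runs verdictProg s (10 + (m + 1) * 50) fun s' => held s' = held s ∧
      (s' 1 0 = 1 ∧ (∀ a < m, held s a ≠ 0) ∨ s' 1 0 = 0 ∧ ∃ a < m, held s a = 0) := by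
  refine Runs.seq (T₁ := 10) (R := fun s' => s' = s.set 1 0 1)
    ((Runs.straight (by simp [wp, Expr.eval])).mono (by decide) fun _ h => h) ?_
  rintro _ rfl
  refine (Runs.forLoop (T := 30) m (fun k s' => s' 26 0 = k ∧ Agree [1, 26] s s' ∧
    held s' = held s ∧ (s' 1 0 = 1 ∧ (∀ a < k, held s a ≠ 0) ∨
      s' 1 0 = 0 ∧ ∃ a < k, held s a = 0)) ?_ ?_ ?_).mono ?_ ?_
  · refine ⟨by simp [Store.set_apply], ?_, ?_, ?_⟩
    · exact ((Agree.refl _ _).set _ _ (by simp)).set _ _ (by simp)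
    · funext x; simp [held, Store.set_apply]
    · simp [Store.set_apply]
  · rintro k s' - ⟨h1, h2, -⟩
    exact ⟨h1, (hT.agree h2 (by simp) (by simp) (by simp)).eval_agents⟩
  · rintro k s' hk ⟨h1, h2, h3, h4⟩
    refine (Runs.straight ?_).mono (by decide) fun _ h => h
    have hk' : s' 1 (k + 1) = held s k := congrFun h3 k
    simp only [wp, Expr.eval, var, h1, hk']
    refine ⟨fun h5 => ⟨by simp [Store.set_apply], h2.set _ _ (by simp), ?_, ?_⟩, fun h5 =>
      ⟨by simp [Store.set_apply, h1], (h2.set _ _ (by simp)).set _ _ (by simp), ?_, ?_⟩⟩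
    · rw [← h3]; funext x; simp [held, Store.set_apply]
    · simp only [Store.set_apply, Nat.reduceEqDiff, false_and, if_false]
      rcases h4 with ⟨h4, h6⟩ | ⟨h4, a, ha, h6⟩
      · refine Or.inl ⟨by simpa using h4, fun a ha => ?_⟩
        rcases Nat.lt_succ_iff_lt_or_eq.1 ha with ha | rfl
        · exact h6 a ha
        · exact h5
      · exact Or.inr ⟨by simpa using h4, a, by omega, h6⟩
    · rw [← h3]; funext x; simp [held, Store.set_apply]
    · exact Or.inr ⟨by simp [Store.set_apply], k, by omega, h5⟩
  · exact Nat.mul_le_mul_left _ (by decide)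
  · exact fun s' h => h.2.2

end Round

/-! ### The layout of the input word -/

section Input

variable {m n : ℕ}

/-- The code of the first `k` rows, where each list is preceded by its length. -/
def rowCode (L : ℕ → List ℕ) (k : ℕ) : List ℕ :=
  (List.range k).flatMap fun x => (L x).length :: L x

theorem rowCode_succ (L : ℕ → List ℕ) (k : ℕ) :
    rowCode L (k + 1) = rowCode L k ++ ((L k).length :: L k) := by
  simp [rowCode, List.range_succ]

theorem rowCode_prefix (L : ℕ → List ℕ) {k N : ℕ} (h : k ≤ N) : rowCode L k <+: rowCode L N := by
  induction N, h using Nat.le_induction with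
  | base => exact List.prefix_rfl
  | succ N _ ih => rw [rowCode_succ]; exact ih.trans (List.prefix_append _ _)

theorem rowCode_eq_append (L : ℕ → List ℕ) {k N : ℕ} (h : k < N) :
    ∃ R, rowCode L N = rowCode L k ++ ((L k).length :: (L k ++ R)) := by
  obtain ⟨R, hR⟩ := rowCode_prefix L (Nat.succ_le_of_lt h)
  exact ⟨R, by rw [← hR, rowCode_succ]; simp⟩

theorem code_eq_flatMap (I : Market m n) :
    I.code = (List.range m).flatMap fun x =>
      if h : x < m then (I.list ⟨x, h⟩).length :: (I.list ⟨x, h⟩).map Fin.val else [] := by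
  unfold Market.code
  rw [← List.map_coe_finRange_eq_range, List.flatMap_map]
  congr 1
  funext a
  simp

/-- Both instances become one list of m + m rows, so that a single loop can read them. -/
theorem inputWord_eq (I J : Market m n) :
    inputWord I J = m :: n :: rowCode (rowList I J) (m + m) := by
  unfold inputWord rowCode
  rw [code_eq_flatMap, code_eq_flatMap, List.range_add, List.flatMap_append, List.flatMap_map]
  congr 3
  · refine List.flatMap_congr fun x hx => ?_
    rw [List.mem_range] at hx
    simp [rowList, hx]
  · refine List.flatMap_congr fun x hx => ?_
    rw [List.mem_range] at hx
    simp [rowList, hx]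

/-- The position of row `k` in the input word. -/
def rowPos (I J : Market m n) (k : ℕ) : ℕ := 2 + (rowCode (rowList I J) k).length

theorem rowPos_succ (I J : Market m n) (k : ℕ) :
    rowPos I J (k + 1) = rowPos I J k + 1 + (rowList I J k).length := by
  simp [rowPos, rowCode_succ]; omega

theorem inputStore_length (I J : Market m n) {k : ℕ} (hk : k < m + m) :
    inputStore (inputWord I J) 0 (rowPos I J k) = (rowList I J k).length := by
  obtain ⟨R, hR⟩ := rowCode_eq_append (rowList I J) hk
  rw [inputWord_eq, hR, rowPos, Nat.add_comm 2]
  simp [inputStore]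

theorem inputStore_entry (I J : Market m n) {k i : ℕ} (hk : k < m + m)
    (hi : i < (rowList I J k).length) :
    inputStore (inputWord I J) 0 (rowPos I J k + 1 + i) = (rowList I J k)[i] := by
  obtain ⟨R, hR⟩ := rowCode_eq_append (rowList I J) hk
  have : rowPos I J k + 1 + i = (rowCode (rowList I J) k).length + (i + 1) + 2 := by
    rw [rowPos]; omega
  rw [inputWord_eq, hR, this]
  simp [inputStore, List.getElem?_append_left hi, List.getElem?_append_right, hi]

end Input

/-! ### Building the tables; correctness and running time of the whole program -/

section Setup

variable {m n : ℕ}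

/-- Copies the list at the input position in array `11` to the rank table. -/
def readList : Prog :=
  forLoop 14 (var 15) (.seq (.write 2 (.plus (var 12) (.read 0 (var 11))) (.plus (var 14) (.const 1)))
    (assign 11 (.plus (var 11) (.const 1))))

theorem runs_readList {I J : Market m n} {k : ℕ} (hk : k < m + m) {s : Store}
    (h0 : s 0 = inputStore (inputWord I J) 0) (h11 : s 11 0 = rowPos I J k + 1)
    (h12 : s 12 0 = k * (n + m)) (h15 : s 15 0 = (rowList I J k).length)
    (h2 : ∀ i, k * (n + m) ≤ i → s 2 i = 0) :
    Runs readList s ((n + 1) * 50) fun s' => Agree [2, 11, 14] s s' ∧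
      s' 11 0 = rowPos I J (k + 1) ∧ (∀ i < k * (n + m), s' 2 i = s 2 i) ∧
      ∀ c, s' 2 (k * (n + m) + c) =
        if c ∈ rowList I J k then (rowList I J k).idxOf c + 1 else 0 := by
  set l := rowList I J k with hl
  refine (Runs.forLoop (T := 30) l.length (fun j s' => s' 14 0 = j ∧ Agree [2, 11, 14] s s' ∧
    s' 11 0 = rowPos I J k + 1 + j ∧ (∀ i < k * (n + m), s' 2 i = s 2 i) ∧
    ∀ c, s' 2 (k * (n + m) + c) = if c ∈ l.take j then l.idxOf c + 1 else 0) ?_ ?_ ?_).mono ?_ ?_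
  · refine ⟨by simp [Store.set_apply], (Agree.refl _ _).set _ _ (by simp),
      by simp [Store.set_apply, h11], by simp [Store.set_apply], fun c => ?_⟩
    simp [Store.set_apply, h2]
  · rintro j s' - ⟨h1, h2, -⟩
    refine ⟨h1, ?_⟩
    rw [eval_var, h2 15 (by simp), h15]
  · rintro j s' hj ⟨h3, h4, h5, h6, h7⟩
    refine (Runs.straight ?_).mono (by decide) fun _ h => h
    have e0 : s' 0 (s' 11 0) = l[j] := by
      rw [h5, h4 0 (by simp), h0]
      exact inputStore_entry I J hk hj
    have e12 : s' 12 0 = k * (n + m) := by rw [h4 12 (by simp), h12]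
    simp only [wp, assign, Expr.eval, var, e0, e12, h3, Store.set_apply, Nat.reduceEqDiff,
      false_and, if_false, and_self, if_true]
    refine ⟨trivial,
      ((h4.set _ _ (by simp)).set _ _ (by simp)).set _ _ (by simp), by rw [h5]; omega, ?_, ?_⟩
    · intro i hi
      rw [if_neg (by omega)]
      exact h6 i hi
    · intro c
      -- Without repetitions, the counter plus one is the rank of the entry just read, and no
      -- earlier rank is overwritten.
      have hidx : l.idxOf l[j] = j := (nodup_rowList I J k).idxOf_getElem j hj
      simp only [true_and, Nat.add_left_cancel_iff]
      rw [← List.take_concat_get' l j hj]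
      simp only [List.mem_append, List.mem_singleton]
      by_cases hc : c = l[j]
      · rw [if_pos hc, if_pos (Or.inr hc), hc, hidx]
      · rw [if_neg hc, h7]
        simp only [hc, or_false]
  · have := length_rowList_le I J k
    rw [← hl] at this
    exact Nat.mul_le_mul (by omega) (by decide)
  · rintro s' ⟨-, h3, h4, h5, h6⟩
    refine ⟨h3, by rw [h4, rowPos_succ], h5, fun c => ?_⟩
    rw [h6, List.take_length]

/-- Reads one row of the input. -/
def rowProg : Prog :=
  .seq (.seq (.write 3 (var 13) (var 12)) (.seq (assign 15 (.read 0 (var 11)))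
    (assign 11 (.plus (var 11) (.const 1)))))
  (.seq readList
  (.seq (.cond (.minus agents (var 13)) (assign 16 (.plus jobs (var 13)))
    (assign 16 (.minus (.plus jobs (var 13)) agents)))
  (.seq (.write 2 (.plus (var 12) (var 16)) (.plus jobs (.const 1)))
  (.seq (.write 4 (var 16) (.const 1)) (assign 12 (.plus (var 12) slots))))))

/-- The first `k` rows have been read. -/
structure RowsRead (I J : Market m n) (k : ℕ) (s : Store) : Prop where
  agree : Agree [2, 3, 4, 11, 12, 13, 14, 15, 16] (inputStore (inputWord I J)) s
  index : s 13 0 = k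
  pos : s 11 0 = rowPos I J k
  offset : s 12 0 = k * (n + m)
  row : ∀ x < k, s 3 x = x * (n + m)
  rank : ∀ x < k, ∀ c < n + m, s 2 (x * (n + m) + c) = rankOf I J x c
  zero : ∀ i, k * (n + m) ≤ i → s 2 i = 0
  level : ∀ x < k, s 4 (n + rowAgent m x) = 1

theorem inputStore_agents (I J : Market m n) : inputStore (inputWord I J) 0 0 = m := rfl

theorem inputStore_jobs (I J : Market m n) : inputStore (inputWord I J) 0 1 = n := rfl

/-- There is no multiplication, so the offsets x(n + m) are accumulated by addition and stored.
Cells beyond the rows read are still zero, the rank of a non-neighbour, so only true entries have to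
be written. -/
theorem runs_rowProg {I J : Market m n} {k : ℕ} (hk : k < m + m) {s : Store}
    (h : RowsRead I J k s) : Runs rowProg s (100 + (n + 1) * 50) fun s' =>
      RowsRead I J (k + 1) (s'.set 13 0 (s' 13 0 + 1)) := by
  have h0 : s 0 = inputStore (inputWord I J) 0 := h.agree 0 (by simp)
  refine (Runs.seq (T₁ := 30) (R := fun s' => Agree [3, 11, 15] s s' ∧ s' 11 0 = rowPos I J k + 1 ∧
    s' 15 0 = (rowList I J k).length ∧ s' 3 = Function.update (s 3) k (k * (n + m))) ?_
    (T₂ := (n + 1) * 50 + 70) ?_).mono (by omega) fun _ h => h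
  · refine (Runs.straight ?_).mono (by decide) fun _ h => h
    simp only [wp, assign, Expr.eval, var, Store.set_apply, h.index, h.offset, h.pos,
      Nat.reduceEqDiff, false_and, if_false, and_self, if_true, h0, inputStore_length I J hk]
    refine ⟨(((Agree.refl _ _).set _ _ (by simp)).set _ _ (by simp)).set _ _ (by simp), trivial,
      trivial, ?_⟩
    · funext i
      simp [Store.set_apply, Function.update_apply]
  · rintro s₁ ⟨hag₁, h11, h15, h3⟩
    have hz : ∀ i, k * (n + m) ≤ i → s₁ 2 i = 0 := by
      rw [hag₁ 2 (by simp)]; exact h.zero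
    refine Runs.seq (runs_readList hk (by rw [hag₁ 0 (by simp), h0]) h11
      (by rw [hag₁ 12 (by simp), h.offset]) h15 hz) ?_
    rintro s₂ ⟨hag₂, h11', hold, hnew⟩
    have hag : Agree [2, 3, 11, 14, 15] s s₂ := (hag₁.mono (by simp)).trans (hag₂.mono (by simp))
    have e0 : s₂ 0 = inputStore (inputWord I J) 0 := by rw [hag 0 (by simp), h0]
    have em : s₂ 0 0 = m := by rw [e0]; rfl
    have en : s₂ 0 1 = n := by rw [e0]; rfl
    have e13 : s₂ 13 0 = k := by rw [hag 13 (by simp), h.index]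
    have e12 : s₂ 12 0 = k * (n + m) := by rw [hag 12 (by simp), h.offset]
    have e3 : s₂ 3 = Function.update (s 3) k (k * (n + m)) := by rw [hag₂ 3 (by simp), h3]
    have e4 : s₂ 4 = s 4 := hag 4 (by simp)
    have hold' : ∀ i < k * (n + m), s₂ 2 i = s 2 i := fun i hi => by
      rw [hold i hi, hag₁ 2 (by simp)]
    have hra : rowAgent m k < m := by unfold rowAgent; split_ifs <;> omega
    refine (Runs.seq (T₁ := 40) (T₂ := 30) (R := fun s' => s' = s₂.set 16 0 (n + rowAgent m k))
      ?_ ?_).mono le_rfl fun _ h => h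
    · refine (Runs.straight ?_).mono (by decide) fun _ h => h
      simp only [wp, assign, Expr.eval, var, agents, jobs, em, en, e13]
      refine ⟨fun hc => ?_, fun hc => ?_⟩
      · rw [rowAgent, if_pos (by omega)]
      · rw [rowAgent, if_neg (by omega), Nat.add_sub_assoc (by omega)]
    · rintro _ rfl
      refine (Runs.straight ?_).mono (by decide) fun _ h => h
      simp only [wp, assign, Expr.eval, var, slots, agents, jobs, Store.set_apply, Nat.reduceEqDiff,
        false_and, if_false, and_self, if_true, e12]
      simp only [em, en]
      have hagf : Agree [2, 3, 4, 11, 12, 13, 14, 15, 16] (inputStore (inputWord I J)) s₂ :=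
        h.agree.trans (hag.mono (by simp))
      refine ⟨((((hagf.set _ _ (by simp)).set _ _ (by simp)).set _ _ (by simp)).set _ _
        (by simp)).set _ _ (by simp), ?_, ?_, ?_, ?_, ?_, ?_, ?_⟩
      · simp [Store.set_apply, e13]
      · simp [Store.set_apply, h11']
      · simp [Store.set_apply]; ring
      · intro x hx
        simp only [Store.set_apply, Nat.reduceEqDiff, false_and, if_false, e3]
        by_cases hxk : x = k
        · rw [hxk, Function.update_self]
        · rw [Function.update_of_ne hxk]
          exact h.row x (by omega)
      · intro x hx c hc
        simp only [Store.set_apply, Nat.reduceEqDiff, false_and, if_false, true_and]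
        by_cases hxk : x = k
        · subst hxk
          rw [hnew c]
          simp only [Nat.add_left_cancel_iff]
          unfold rankOf
          split_ifs <;>
            first | rfl | omega | exact absurd (mem_rowList_lt I J x (by assumption)) (by assumption)
        · have hlt : x * (n + m) + c < k * (n + m) := by
            have : (x + 1) * (n + m) ≤ k * (n + m) := Nat.mul_le_mul_right _ (by omega)
            rw [Nat.succ_mul] at this
            omega
          rw [if_neg (by omega), hold' _ hlt]
          exact h.rank x (by omega) c hc
      · intro i hi
        rw [Nat.succ_mul] at hi
        simp only [Store.set_apply, Nat.reduceEqDiff, false_and, if_false, true_and]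
        rw [if_neg (by omega)]
        obtain ⟨c, rfl⟩ := Nat.exists_eq_add_of_le (show k * (n + m) ≤ i by omega)
        rw [hnew, if_neg fun hc => ?_]
        have := mem_rowList_lt I J k hc
        omega
      · intro x hx
        simp only [Store.set_apply, Nat.reduceEqDiff, false_and, if_false, true_and, e4]
        by_cases hxk : x = k
        · subst hxk; simp
        · rw [h.level x (by omega)]; simp

/-- Reads the input and prepares the first round. -/
def setupProg : Prog :=
  .seq (assign 11 (.const 2)) (.seq (forLoop 13 (.plus agents agents) rowProg)
    (.seq (forLoop 13 jobs (.write 4 (var 13) (.const 2))) (assign 20 (.const 1))))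

/-- A bound for the running time of the setup. -/
def setupTime (m n : ℕ) : ℕ :=
  10 + ((m + m + 1) * (120 + (n + 1) * 50) + ((n + 1) * 50 + 10))

theorem runs_setupProg (I J : Market m n) :
    Runs setupProg (inputStore (inputWord I J)) (setupTime m n) fun s =>
      MainInv m n (rankOf I J) s ∧ s 20 0 = 1 := by
  refine Runs.seq (R := fun s => s = (inputStore (inputWord I J)).set 11 0 2)
    ((Runs.straight (c := assign 11 (.const 2))
      (Q := fun s => s = (inputStore (inputWord I J)).set 11 0 2) rfl).mono (by decide) fun _ h => h) ?_
  rintro _ rfl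
  refine Runs.seq (R := RowsRead I J (m + m)) ((Runs.forLoop (T := 100 + (n + 1) * 50) (m + m)
    (RowsRead I J) ?_ ?_ ?_).mono ?_ fun _ h => h) ?_
  · refine ⟨?_, ?_, ?_, ?_, ?_, ?_, ?_, ?_⟩
    · exact ((Agree.refl _ _).set _ _ (by simp)).set _ _ (by simp)
    all_goals simp [Store.set_apply, inputStore, rowPos, rowCode]
  · intro k s _ h
    refine ⟨h.index, ?_⟩
    have h0 : s 0 = inputStore (inputWord I J) 0 := h.agree 0 (by simp)
    simp only [Expr.eval, agents, h0, inputStore_agents]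
  · exact fun k s hk h => runs_rowProg hk h
  · refine Nat.mul_le_mul_left _ ?_
    have : (Expr.plus agents agents).cost = 5 := rfl
    omega
  intro s h
  refine Runs.seq (R := fun s' => Agree [4, 13] s s' ∧ (∀ b < n, s' 4 b = 2) ∧
    ∀ t, n ≤ t → s' 4 t = s 4 t) ?_ (T₂ := 10) ?_
  · refine (Runs.forLoop (T := 20) n (fun k s' => s' 13 0 = k ∧ Agree [4, 13] s s' ∧
      (∀ b < k, s' 4 b = 2) ∧ ∀ t, n ≤ t → s' 4 t = s 4 t) ?_ ?_ ?_).mono ?_ ?_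
    · exact ⟨by simp [Store.set_apply], (Agree.refl _ _).set _ _ (by simp), by simp,
        by simp [Store.set_apply]⟩
    · rintro k s' - ⟨h1, h2, -⟩
      have h0 : s' 0 = inputStore (inputWord I J) 0 :=
        (h2 0 (by simp)).trans (h.agree 0 (by simp))
      exact ⟨h1, by simp only [Expr.eval, jobs, h0, inputStore_jobs]⟩
    · rintro k s' hk ⟨h1, h2, h3, h4⟩
      refine (Runs.straight ?_).mono (by decide) fun _ h => h
      simp only [wp, Expr.eval, var, h1]
      refine ⟨by simp [Store.set_apply, h1], (h2.set _ _ (by simp)).set _ _ (by simp), ?_, ?_⟩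
      · intro b hb
        simp only [Store.set_apply, Nat.reduceEqDiff, false_and, if_false, true_and]
        split_ifs with hbk
        · rfl
        · exact h3 b (by omega)
      · intro t ht
        simp only [Store.set_apply, Nat.reduceEqDiff, false_and, if_false, true_and]
        rw [if_neg (by omega), h4 t ht]
    · exact Nat.mul_le_mul_left _ (by decide)
    · exact fun s' h => h.2
  · rintro s₁ ⟨h1, h2, h3⟩
    refine (Runs.straight ?_).mono (by decide) fun _ h => h
    have hag : Agree [2, 3, 4, 11, 12, 13, 14, 15, 16, 20] (inputStore (inputWord I J))
        (s₁.set 20 0 1) :=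
      ((h.agree.mono (by simp)).trans (h1.mono (by simp))).set _ _ (by simp)
    have e4 : (s₁.set 20 0 1) 4 = s₁ 4 := Store.set_ne _ _ _ (by simp)
    have e2 : (s₁.set 20 0 1) 2 = s 2 := by
      rw [Store.set_ne _ _ _ (by simp), h1 2 (by simp)]
    have e3 : (s₁.set 20 0 1) 3 = s 3 := by
      rw [Store.set_ne _ _ _ (by simp), h1 3 (by simp)]
    have e20 : (s₁.set 20 0 1) 20 0 = 1 := by simp [Store.set_apply]
    simp only [wp, assign, Expr.eval]
    generalize s₁.set 20 0 1 = s₂ at hag e4 e2 e3 e20 ⊢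
    have e0 := hag 0 (by simp)
    have hz : ∀ r, r ≠ 0 → r ∉ [2, 3, 4, 11, 12, 13, 14, 15, 16, 20] → ∀ i, s₂ r i = 0 := by
      intro r hr hr' i
      rw [hag r hr']
      simp [inputStore, hr]
    refine ⟨⟨⟨by rw [e0]; rfl, by rw [e0]; rfl, by rw [e3]; exact h.row, by rw [e2]; exact h.rank⟩,
      ?_, ?_, ?_, hz 1 (by simp) (by simp) 0, fun h0 => by omega⟩, e20⟩
    · rw [e4]
      refine UpperLevels.initial h2 fun a ha => ?_
      rw [h3 _ (by omega)]
      have := h.level a (by omega)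
      rwa [rowAgent, if_pos ha] at this
    · rw [hz 21 (by simp) (by simp)]
      exact AuctionState.reset _ (fun a _ => hz 1 (by simp) (by simp) _)
        (fun t _ => hz 6 (by simp) (by simp) t) fun t _ => hz 5 (by simp) (by simp) t
    · rw [hz 21 (by simp) (by simp)]; omega

/-- Decides whether there is a robust popular matching and finds one. -/
def robustProg : Prog := .seq setupProg (.seq mainLoop verdictProg)

/-- A bound for the running time of `robustProg`. -/
def totalTime (m n : ℕ) : ℕ :=
  setupTime m n + ((roundBound m n + 1) * (roundTime m n + 3) + (10 + (m + 1) * 50))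

/-- An outside option is stored as a number above n, which is never b + 1 for a job b. The output
convention therefore reads it as unmatched. -/
theorem outputEdges_eq {s : Store} (h : ∀ a < m, held s a ≠ 0) :
    outputEdges m n s = edgesOf (jobAssign m n fun a => held s a - 1) := by
  ext ⟨a, b⟩
  rw [mem_edgesOf, jobAssign_eq_some]
  have := h a a.2
  simp only [outputEdges, Finset.mem_filter, Finset.mem_univ, true_and]
  change held s a = b + 1 ↔ _
  omega

theorem runs_robustProg {I J : Market m n} (hIJ : I.DifferInOneAgent J) :
    Runs robustProg (inputStore (inputWord I J)) (totalTime m n) fun s =>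
      (verdict s = 1 ∧ I.IsRobustPopular J (outputEdges m n s)) ∨
        (verdict s = 0 ∧ ¬ ∃ M, I.IsRobustPopular J M) := by
  have hR := rankTable_rankOf I J
  refine Runs.seq (runs_setupProg I J) fun s₁ h₁ => ?_
  refine Runs.seq (runs_mainLoop hR h₁.1 h₁.2) fun s₂ h₂ => ?_
  obtain ⟨hinv, hzero⟩ := h₂
  obtain ⟨hph, hno⟩ := hinv.halted hzero
  refine (runs_verdictProg hinv.tables).mono le_rfl ?_
  rintro s₃ ⟨hheld, ⟨hv, hall⟩ | ⟨hv, a, ha, hfree⟩⟩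
  · refine Or.inl ⟨hv, ?_⟩
    rw [outputEdges_eq (by rw [hheld]; exact hall), hheld]
    exact ((hinv.auction.solution hinv.upper.lev hph hall).certifies hIJ.1).isRobustPopular hIJ.1
  · refine Or.inr ⟨hv, fun hex => ?_⟩
    obtain ⟨F, U, hsol⟩ := (exists_isRobustPopular_iff hIJ).1 hex
    exact hinv.auction.not_solution_of_free hR hinv.upper hno hph ha hfree hsol

/-- Monotonicity allows both parameters to be replaced by the size of the instance, leaving a
polynomial in one variable. -/
theorem totalTime_mono {m m' n n' : ℕ} (hm : m ≤ m') (hn : n ≤ n') :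
    totalTime m n ≤ totalTime m' n' := by
  unfold totalTime setupTime roundBound roundTime priceBound
  gcongr

theorem exists_polynomial_totalTime :
    ∃ p : Polynomial ℕ, ∀ x, p.eval x = totalTime x x := by
  let X : Polynomial ℕ := Polynomial.X
  let B : Polynomial ℕ := (X + X) * (X + 2) + 1
  refine ⟨(10 + ((X + X + 1) * (120 + (X + 1) * 50) + ((X + 1) * 50 + 10))) +
    ((3 * B + 2 * X * (2 * B) + 1) * ((10 + (X + 1) * (50 + (X + X + 1) * (200 + (X + 1) * 150)) +
      (100 + (X + 1) * 100 + (X + X + 1) * 100)) + 3) + (10 + (X + 1) * 50)), fun x => ?_⟩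
  simp [X, B, totalTime, setupTime, roundBound, roundTime, priceBound]

end Setup

end PopularMatching

theorem mainTheorem3 :
    ∃ (c : PopularMatching.Prog) (p : Polynomial ℕ),
      ∀ (m n : ℕ) (I J : PopularMatching.Market m n), I.DifferInOneAgent J →
        ∃ (s : PopularMatching.Store) (t : ℕ),
          PopularMatching.Exec c
            (PopularMatching.inputStore (PopularMatching.inputWord I J)) s t ∧
          t ≤ p.eval I.size ∧
          ((PopularMatching.verdict s = 1 ∧
              I.IsRobustPopular J (PopularMatching.outputEdges m n s)) ∨
            (PopularMatching.verdict s = 0 ∧ ¬ ∃ M, I.IsRobustPopular J M)) := by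
  obtain ⟨p, hp⟩ := PopularMatching.exists_polynomial_totalTime
  refine ⟨PopularMatching.robustProg, p, fun m n I J hIJ => ?_⟩
  obtain ⟨s, t, he, ht, hs⟩ := PopularMatching.runs_robustProg hIJ
  refine ⟨s, t, he, ht.trans ?_, hs⟩
  rw [hp]
  have hm : m ≤ I.size := by unfold PopularMatching.Market.size; omega
  have hn : n ≤ I.size := by unfold PopularMatching.Market.size; omega
  exact PopularMatching.totalTime_mono hm hn
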